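/- Let $c, D, r, \eta_\infty > 0$, let $e(\eta) = \eta_\infty/(\eta_\infty-\eta)$ for $0 \le \eta < \eta_\infty$, and let $\mathbb S^2$ be the unit sphere with spherical coordinates $(\theta,\varphi)$ and surface measure $\sin\theta\,d\theta\,d\varphi$. Let $T$ be a centered isotropic real Gaussian random field on $\mathbb S^2$, defined on a probability space $\Omega$, with $T \in L^2(\mathbb S^2\times\Omega)$. Let $a_{lm} = \int_{\mathbb S^2} T\, Y_{lm}^*$ be its coefficients with respect to the spherical harmonics $Y_{lm}$ ($l \ge 0$, $-l\le m\le l$), and let $C_l = E|a_{lm}|^2$ be its angular power spectrum (this value does not depend on $m$). Let $u(\eta,\cdot)\in L^2(\mathbb S^2\times\Omega)$, $0\le\eta<\eta_\infty$, be the solution of the initial value problem $$\left(\frac{e(\eta)}{D}+\frac{e'(\eta)}{c^2 e(\eta)}\right)\frac{\partial u}{\partial\eta}+\frac1{c^2}\frac{\partial^2u}{\partial\eta^2}-\frac1{r^2}\left(\frac{\partial^2u}{\partial\theta^2}+\cot\theta\,\frac{\partial u}{\partial\theta}+\frac1{\sin^2\theta}\frac{\partial^2u}{\partial\varphi^2}\right)=0,\qquad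 u|_{\eta=0}=T,\quad \frac{\partial u}{\partial\eta}\Big|_{\eta=0}=0,$$ understood weakly in $L^2(\mathbb S^2\times\Omega)$: for every $\psi\in C^\infty(\mathbb S^2)$ and every $\chi\in L^2(\Omega)$ the function $g(\eta)=E\big[\chi\int_{\mathbb S^2}u(\eta,\cdot)\psi\big]$ is twice differentiable on $[0,\eta_\infty)$, satisfies $g'(0)=0$ and $$\left(\frac{e(\eta)}{D}+\frac{e'(\eta)}{c^2 e(\eta)}\right)g'(\eta)+\frac1{c^2}g''(\eta)-\frac1{r^2}E\Big[\chi\int_{\mathbb S^2}u(\eta,\cdot)\,\Delta_{\mathbb S^2}\psi\Big]=0,$$ where $\Delta_{\mathbb S^2}$ is the Laplace–Beltrami operator, and $u(0,\cdot)=T$ in $L^2(\mathbb S^2\times\Omega)$. If $\sum_{l=1}^\infty C_l\, l^3<\infty$, then there is a constant $C$ such that, for all $\eta\in[0,\eta_\infty)$ and all $h\in(0,\eta_\infty-\eta)$, $$\|u(\eta+h,\cdot)-u(\eta,\cdot)\|_{L^2(\mathbb S^2\times\Omega)}\le C\,h .$$ -/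

import Mathlib

open MeasureTheory ProbabilityTheory Set

noncomputable section

/-- Euclidean space `ℝ³`. -/
abbrev E3 : Type := EuclideanSpace ℝ (Fin 3)

/-- The unit sphere `S²` in `ℝ³`. -/
abbrev Sphere2 : Type := Metric.sphere (0 : E3) 1

lemma sphVec_mem (p : ℝ × ℝ) :
    (!₂[Real.cos p.1, Real.sin p.1 * Real.cos p.2, Real.sin p.1 * Real.sin p.2] : E3) ∈
      Metric.sphere (0 : E3) 1 := by
  have h : (Real.cos p.1) ^ 2 + (Real.sin p.1 * Real.cos p.2) ^ 2
      + (Real.sin p.1 * Real.sin p.2) ^ 2 = 1 := by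
    have h1 := Real.sin_sq_add_cos_sq p.1
    have h2 := Real.sin_sq_add_cos_sq p.2
    linear_combination h1 + (Real.sin p.1) ^ 2 * h2
  simp [EuclideanSpace.norm_eq, Fin.sum_univ_three, h]

/-- The point of `S²` with spherical coordinates `p = (θ, φ)`. -/
def sphPoint (p : ℝ × ℝ) : Sphere2 :=
  ⟨!₂[Real.cos p.1, Real.sin p.1 * Real.cos p.2, Real.sin p.1 * Real.sin p.2], sphVec_mem p⟩

/-- The surface measure of the sphere in spherical coordinates:
`sin θ dθ dφ` on `[0, π] × [0, 2π)`. -/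
def angleMeasure : Measure (ℝ × ℝ) :=
  (volume.restrict (Icc 0 Real.pi ×ˢ Ico 0 (2 * Real.pi))).withDensity
    fun p => ENNReal.ofReal (Real.sin p.1)

/-- The Legendre polynomial `P_l = (1 / (2^l l!)) (d/dx)^l (x² - 1)^l`. -/
def legendrePoly (l : ℕ) : Polynomial ℝ :=
  Polynomial.C (1 / (2 ^ l * (l.factorial : ℝ))) *
    Polynomial.derivative^[l] ((Polynomial.X ^ 2 - 1) ^ l)

/-- The associated Legendre function of order `m ≥ 0`,
`P_l^m(x) = (-1)^m (1 - x²)^{m/2} (d/dx)^m P_l(x)`. -/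
def assocLegendreNat (l m : ℕ) (x : ℝ) : ℝ :=
  (-1) ^ m * Real.sqrt (1 - x ^ 2) ^ m * (Polynomial.derivative^[m] (legendrePoly l)).eval x

/-- The associated Legendre function of order `m ∈ {-l, …, l}`; negative orders are given by the
usual convention `P_l^{-k} = (-1)^k ((l-k)! / (l+k)!) P_l^k`. -/
def assocLegendre (l : ℕ) (m : ℤ) (x : ℝ) : ℝ :=
  if 0 ≤ m then assocLegendreNat l m.toNat x
  else (-1) ^ m.natAbs * (((l - m.natAbs).factorial : ℝ) / ((l + m.natAbs).factorial : ℝ)) *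
    assocLegendreNat l m.natAbs x

/-- The normalizing factor `d_{lm} = (-1)^m √((2l+1)/(4π) · (l-m)!/(l+m)!)`. -/
def sphNorm (l : ℕ) (m : ℤ) : ℝ :=
  (-1) ^ m.natAbs * Real.sqrt ((2 * l + 1) / (4 * Real.pi) *
    ((((l : ℤ) - m).toNat.factorial : ℝ) / (((l : ℤ) + m).toNat.factorial : ℝ)))

/-- The spherical harmonic `Y_{lm}(θ, φ) = d_{lm} exp(i m φ) P_l^m(cos θ)`, for `-l ≤ m ≤ l`. -/
def sphHarmonic (l : ℕ) (m : ℤ) (p : ℝ × ℝ) : ℂ :=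
  (sphNorm l m : ℂ) * Complex.exp (Complex.I * (m : ℂ) * (p.2 : ℂ)) *
    (assocLegendre l m (Real.cos p.1) : ℂ)

section Fields

variable {Ω : Type*} [MeasurableSpace Ω]

/-- A random field `T` on the sphere is in `L²(S² × Ω)`. -/
def IsSquareIntegrableField (μ : Measure Ω) (T : Sphere2 → Ω → ℝ) : Prop :=
  MemLp (fun p : (ℝ × ℝ) × Ω => T (sphPoint p.1) p.2) 2 (angleMeasure.prod μ)

/-- The norm of `L²(S² × Ω)`, with values in `[0, ∞]`. -/
def fieldNorm (μ : Measure Ω) (T : Sphere2 → Ω → ℝ) : ENNReal :=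
  eLpNorm (fun p : (ℝ × ℝ) × Ω => T (sphPoint p.1) p.2) 2 (angleMeasure.prod μ)

/-- The image of a point of the sphere under a linear isometry of `ℝ³`. -/
def moveSphere (A : E3 ≃ₗᵢ[ℝ] E3) (x : Sphere2) : Sphere2 :=
  ⟨A x, by simp⟩

/-- The finite-dimensional distributions of `T` are invariant under rotations. -/
def IsIsotropic (μ : Measure Ω) (T : Sphere2 → Ω → ℝ) : Prop :=
  ∀ A : E3 ≃ₗᵢ[ℝ] E3, LinearMap.det (A.toLinearEquiv : E3 →ₗ[ℝ] E3) = 1 →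
    ∀ (k : ℕ) (x : Fin k → Sphere2),
      IdentDistrib (fun ω i => T (moveSphere A (x i)) ω) (fun ω i => T (x i) ω) μ μ

/-- A centered isotropic Gaussian random field on the sphere, in `L²(S² × Ω)`. -/
structure IsIsotropicGaussianField (μ : Measure Ω) (T : Sphere2 → Ω → ℝ) : Prop where
  gaussian : IsGaussianProcess T μ
  centered : ∀ x, ∫ ω, T x ω ∂μ = 0
  isotropic : IsIsotropic μ T
  memL2 : IsSquareIntegrableField μ T

/-- The random Laplace coefficient `a_{lm} = ∫ T Y_{lm}^* sin θ dθ dφ`. -/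
def laplaceCoeff (T : Sphere2 → Ω → ℝ) (l : ℕ) (m : ℤ) (ω : Ω) : ℂ :=
  ∫ p, (T (sphPoint p) ω : ℂ) * (starRingEnd ℂ) (sphHarmonic l m p) ∂angleMeasure

/-- The angular power spectrum `C_l` of an isotropic field. For such a field `E|a_{lm}|²` is the
same number `C_l` for all `m ∈ {-l, …, l}`; it is written here as the mean over `m`
(see `angularPowerSpectrum_eq`). -/
def angularPowerSpectrum (μ : Measure Ω) (T : Sphere2 → Ω → ℝ) (l : ℕ) : ℝ :=
  (∑ m ∈ Finset.Icc (-(l : ℤ)) l, ∫ ω, ‖laplaceCoeff T l m ω‖ ^ 2 ∂μ) / (2 * l + 1)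

/-- If `E a_{lm} a_{l'm'}^* = δ_{ll'} δ_{mm'} C_l`, then `C` is the angular power spectrum. -/
lemma angularPowerSpectrum_eq (μ : Measure Ω) (T : Sphere2 → Ω → ℝ) (C : ℕ → ℝ)
    (h : ∀ (l l' : ℕ), ∀ m ∈ Finset.Icc (-(l : ℤ)) l, ∀ m' ∈ Finset.Icc (-(l' : ℤ)) l',
      ∫ ω, laplaceCoeff T l m ω * (starRingEnd ℂ) (laplaceCoeff T l' m' ω) ∂μ =
        if l = l' ∧ m = m' then (C l : ℂ) else 0) (l : ℕ) :
    angularPowerSpectrum μ T l = C l := by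
  have h1 : ∀ m ∈ Finset.Icc (-(l : ℤ)) l, ∫ ω, ‖laplaceCoeff T l m ω‖ ^ 2 ∂μ = C l := by
    intro m hm
    have h2 := h l l m hm m hm
    simp only [Complex.mul_conj', and_self, if_true] at h2
    have h3 : ∫ ω, ((‖laplaceCoeff T l m ω‖ ^ 2 : ℝ) : ℂ) ∂μ = (C l : ℂ) := by
      rw [← h2]; congr 1; ext ω; push_cast; rfl
    rw [integral_complex_ofReal] at h3
    exact_mod_cast h3
  unfold angularPowerSpectrum
  rw [Finset.sum_congr rfl h1, Finset.sum_const, Int.card_Icc, nsmul_eq_mul]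
  have h4 : (((l : ℤ) + 1 - -(l : ℤ)).toNat : ℝ) = 2 * l + 1 := by
    have : ((l : ℤ) + 1 - -(l : ℤ)).toNat = 2 * l + 1 := by omega
    rw [this]; push_cast; ring
  rw [h4]
  have h5 : (2 * (l : ℝ) + 1) ≠ 0 := by positivity
  field_simp

end Fields

/-- The expansion factor in conformal time, `e(η) = η_∞ / (η_∞ - η)`. -/
def expansionFactor (ηinf η : ℝ) : ℝ := ηinf / (ηinf - η)

/-- The coefficient `e(η)/D + e'(η)/(c² e(η))` of the first time derivative. -/
def dampingCoeff (c D ηinf η : ℝ) : ℝ :=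
  expansionFactor ηinf η / D +
    deriv (expansionFactor ηinf) η / (c ^ 2 * expansionFactor ηinf η)

/-- The Laplace–Beltrami operator of the unit sphere in spherical coordinates, applied to (the
restriction to the sphere of) a function `ψ` on `ℝ³`:
`∂²ψ/∂θ² + cot θ ∂ψ/∂θ + (1 / sin² θ) ∂²ψ/∂φ²`. -/
def sphLaplacian (ψ : E3 → ℝ) (p : ℝ × ℝ) : ℝ :=
  iteratedDeriv 2 (fun t => ψ (sphPoint (t, p.2))) p.1
    + Real.cot p.1 * deriv (fun t => ψ (sphPoint (t, p.2))) p.1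
    + 1 / Real.sin p.1 ^ 2 * iteratedDeriv 2 (fun s => ψ (sphPoint (p.1, s))) p.2

/-- The random field `u(η, ·)`, `0 ≤ η < η_∞`, solves the initial value problem
`(e/D + e'/(c² e)) u_η + (1/c²) u_ηη - (1/r²) Δ_{S²} u = 0`, `u(0, ·) = T`, `u_η(0, ·) = 0`,
with `u(η, ·) ∈ L²(S² × Ω)` for each `η` and the equation understood weakly on `S² × Ω`: it holds
for the pairing of `u(η, ·)` with `ψ ⊗ χ`, for each smooth function `ψ` on the sphere and each
`χ ∈ L²(Ω)`, the (self-adjoint) Laplace–Beltrami operator being moved to `ψ`. Here `g₁` and `g₂`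
are the first and the second time derivative of that pairing (one-sided at `η = 0`). The smooth
functions on the sphere are the restrictions of the smooth functions on `ℝ³`. -/
structure IsSolution {Ω : Type*} [MeasurableSpace Ω] (c D r ηinf : ℝ) (μ : Measure Ω)
    (T : Sphere2 → Ω → ℝ) (u : ℝ → Sphere2 → Ω → ℝ) : Prop where
  memL2 : ∀ η ∈ Ico 0 ηinf, IsSquareIntegrableField μ (u η)
  initial : ∀ᵐ p ∂(angleMeasure.prod μ), u 0 (sphPoint p.1) p.2 = T (sphPoint p.1) p.2
  equation : ∀ ψ : E3 → ℝ, ContDiff ℝ (⊤ : ℕ∞) ψ → ∀ χ : Ω → ℝ, MemLp χ 2 μ →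
    ∃ g₁ g₂ : ℝ → ℝ,
      (∀ η ∈ Ico 0 ηinf, HasDerivWithinAt
        (fun s => ∫ p, u s (sphPoint p.1) p.2 * (ψ (sphPoint p.1) * χ p.2)
          ∂(angleMeasure.prod μ)) (g₁ η) (Ico 0 ηinf) η) ∧
      (∀ η ∈ Ico 0 ηinf, HasDerivWithinAt g₁ (g₂ η) (Ico 0 ηinf) η) ∧
      (∀ η ∈ Ico 0 ηinf, dampingCoeff c D ηinf η * g₁ η + 1 / c ^ 2 * g₂ η
        - 1 / r ^ 2 * ∫ p, u η (sphPoint p.1) p.2 * (sphLaplacian ψ p.1 * χ p.2)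
          ∂(angleMeasure.prod μ) = 0) ∧
      g₁ 0 = 0

end

noncomputable section

/-! Expand in spherical harmonics. For fixed `χ ∈ L²(Ω)` the pairing `g(η)` of `u(η, ·)` with a
harmonic of degree `l` times `χ` solves the scalar equation `d g' + g''/c² + (l(l+1)/r²) g = 0`,
`g'(0) = 0`, whose damping `d` is nonnegative. The energy `g'²/c² + (l(l+1)/r²) g²` therefore
decreases, so `|g'| ≤ (c/r) √(l(l+1)) |g(0)|` and `g` is Lipschitz
(`abs_sub_le_of_damped_oscillator`).

This bounds only pairings with a fixed `χ`. Taking for `χ` the increment of the coefficient between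
the two times turns `g(y) - g(x)` into `E χ²`, and Young's inequality gives `E χ² ≤ (c²/r²) l(l+1)
(y-x)² E τ²`, with `τ` the same coefficient of `T` (`integral_realCoeff_increment_sq_le`). Summing
over order and degree, Parseval's identity bounds the squared norm of the increment by `(c²/r²) h² ∑
l(l+1)(2l+1) C_l`, which is controlled by `∑ C_l l³`.

The rest makes the expansion rigorous. Orthonormality comes from the differential equation of the
Legendre polynomials; completeness from the density of polynomial functions on the sphere
(`ae_eq_zero_of_integral_unsignedHarmonic_eq_zero`); the eigenvalue `-l(l+1)` again from that
equation (`polar_laplacian_eq`). The weak equation is tested with real functions smooth on `ℝ³`,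
hence the real and imaginary parts of the harmonics and their polynomial extensions. -/

/-! ### Legendre polynomials: differential equation, orthogonality, normalization -/

open Polynomial in
-- The power `w = (x² - 1)^l` satisfies `(x² - 1) w' = 2 l x w`; differentiate this `n + 1` times.
lemma rodrigues_ode (l n : ℕ) :
    ((X : ℝ[X]) ^ 2 - 1) * derivative^[n + 2] (((X : ℝ[X]) ^ 2 - 1) ^ l)
      + C (2 * ((n : ℝ) + 1 - l)) * X * derivative^[n + 1] (((X : ℝ[X]) ^ 2 - 1) ^ l)
      + C (((n : ℝ) + 1) * (n - 2 * l)) * derivative^[n] (((X : ℝ[X]) ^ 2 - 1) ^ l) = 0 := by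
  induction n with
  | zero =>
    have h1 : ((X : ℝ[X]) ^ 2 - 1) * derivative (((X : ℝ[X]) ^ 2 - 1) ^ l)
        = C (2 * (l : ℝ)) * X * ((X : ℝ[X]) ^ 2 - 1) ^ l := by
      rcases l with _ | l
      · simp
      · simp [derivative_pow]
        ring
    have h2 := congrArg derivative h1
    simp only [derivative_mul, derivative_sub, derivative_X_pow, derivative_one, derivative_C,
      derivative_X] at h2
    simp [C_ofNat] at h2 ⊢
    linear_combination h2
  | succ n ih =>
    have h2 := congrArg derivative ih
    simp only [derivative_mul, derivative_sub, derivative_X_pow, derivative_one, derivative_C,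
      derivative_X, derivative_add, ← Function.iterate_succ_apply' (f := derivative)] at h2
    simp [C_ofNat] at h2 ⊢
    linear_combination h2

open Polynomial in
/-- The equation satisfied by the `m`-th derivative of an eigenfunction of the Legendre operator. -/
def GegenbauerODE (m : ℕ) (lam : ℝ) (p : ℝ[X]) : Prop :=
  (X ^ 2 - 1) * derivative (derivative p) + C (2 * ((m : ℝ) + 1)) * X * derivative p
      + C ((m : ℝ) * (m + 1) - lam) * p = 0

/-- The case `n = m + l` of `rodrigues_ode`, since `(m+l+1)(m-l) = m(m+1) - l(l+1)`. -/
lemma gegenbauerODE_legendre (l m : ℕ) :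
    GegenbauerODE m ((l : ℝ) * (l + 1)) (Polynomial.derivative^[m] (legendrePoly l)) := by
  open Polynomial in
  unfold GegenbauerODE
  have h := rodrigues_ode l (m + l)
  simp only [Function.iterate_succ_apply', show m + l + 2 = (m + l).succ.succ from rfl,
    show m + l + 1 = (m + l).succ from rfl] at h
  simp only [legendrePoly, iterate_derivative_C_mul, ← Function.iterate_add_apply,
    derivative_C_mul]
  set a : ℝ := 1 / (2 ^ l * (l.factorial : ℝ))
  simp [C_ofNat] at h ⊢
  linear_combination C a * h

lemma coeff_iterate_derivative_legendrePoly (l m : ℕ) (hm : m ≤ l) :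
    (Polynomial.derivative^[m] (legendrePoly l)).coeff (l - m)
      = ((l.descFactorial m : ℕ) : ℝ) * (1 / (2 ^ l * (l.factorial : ℝ)) *
          ((2 * l).descFactorial l : ℕ)) := by
  open Polynomial in
  have hw : (((X : ℝ[X]) ^ 2 - 1) ^ l).coeff (2 * l) = 1 := by
    have hmon : ((X : ℝ[X]) ^ 2 - 1).Monic := by
      simpa using monic_X_pow_sub_C (1 : ℝ) (two_ne_zero)
    have hd : ((X : ℝ[X]) ^ 2 - 1).natDegree = 2 := by
      simpa using natDegree_X_pow_sub_C (n := 2) (r := (1 : ℝ))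
    have h := (hmon.pow l).coeff_natDegree
    rwa [hmon.natDegree_pow, hd, mul_comm] at h
  rw [coeff_iterate_derivative, Nat.sub_add_cancel hm, legendrePoly, coeff_C_mul,
    coeff_iterate_derivative, ← two_mul, hw]
  simp

lemma natDegree_iterate_derivative_legendrePoly_le (l m : ℕ) :
    (Polynomial.derivative^[m] (legendrePoly l)).natDegree ≤ l - m := by
  open Polynomial in
  have hd : (((X : ℝ[X]) ^ 2 - 1) ^ l).natDegree ≤ 2 * l := by
    refine natDegree_pow_le.trans ?_
    have : ((X : ℝ[X]) ^ 2 - 1).natDegree = 2 := by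
      simpa using natDegree_X_pow_sub_C (n := 2) (r := (1 : ℝ))
    rw [this, mul_comm]
  have h1 := natDegree_iterate_derivative (((X : ℝ[X]) ^ 2 - 1) ^ l) l
  have h2 : (legendrePoly l).natDegree ≤ l := by
    refine (natDegree_C_mul_le _ _).trans (h1.trans ?_)
    omega
  exact (natDegree_iterate_derivative _ m).trans (by omega)

lemma degree_iterate_derivative_legendrePoly (l m : ℕ) (hm : m ≤ l) :
    (Polynomial.derivative^[m] (legendrePoly l)).degree = ((l - m : ℕ) : WithBot ℕ) := by
  open Polynomial in
  refine degree_eq_of_le_of_coeff_ne_zero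
    (natDegree_le_iff_degree_le.mp (natDegree_iterate_derivative_legendrePoly_le l m)) ?_
  rw [coeff_iterate_derivative_legendrePoly l m hm]
  have h1 : l.descFactorial m ≠ 0 := by rw [Ne, Nat.descFactorial_eq_zero_iff_lt]; omega
  have h2 : (2 * l).descFactorial l ≠ 0 := by rw [Ne, Nat.descFactorial_eq_zero_iff_lt]; omega
  positivity

/-- For fixed `m`, the polynomials `D^m P_l`, `l ≥ m`, span all polynomials. -/
lemma span_iterate_derivative_legendrePoly (m : ℕ) :
    Submodule.span ℝ (range fun n => Polynomial.derivative^[m] (legendrePoly (n + m))) = ⊤ := by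
  -- Shifting the index by `m` leaves exactly one polynomial of each degree.
  let S : Polynomial.Sequence ℝ :=
    ⟨fun n => Polynomial.derivative^[m] (legendrePoly (n + m)), fun n => by
      rw [degree_iterate_derivative_legendrePoly _ _ (by omega)]; simp⟩
  exact S.span fun i => (Polynomial.leadingCoeff_ne_zero.mpr (S.ne_zero i)).isUnit

/-- The pairing of polynomials on `[-1, 1]` with weight `(1 - x²)^k`. -/
def gegIntegral (k : ℕ) (p q : Polynomial ℝ) : ℝ :=
  ∫ x in (-1 : ℝ)..1, (1 - x ^ 2) ^ k * (p.eval x * q.eval x)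

lemma gegIntegral_comm (k : ℕ) (p q : Polynomial ℝ) : gegIntegral k p q = gegIntegral k q p := by
  simp only [gegIntegral, mul_comm (p.eval _)]

/-- Integration by parts; the boundary terms vanish because `1 - x²` occurs to the positive power `k
+ 1`. The identity yields both orthogonality, through its symmetry, and the recursion for the norms.
-/
lemma gegIntegral_derivative (k : ℕ) (lam : ℝ) (p q : Polynomial ℝ) (hp : GegenbauerODE k lam p) :
    gegIntegral (k + 1) (Polynomial.derivative p) (Polynomial.derivative q)
      = (lam - k * (k + 1)) * gegIntegral k p q := by
  open Polynomial in
  have hode : ∀ x : ℝ, (1 - x ^ 2) * (derivative (derivative p)).eval x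
      - 2 * (k + 1) * x * (derivative p).eval x = -(lam - k * (k + 1)) * p.eval x := by
    intro x
    have := congrArg (eval x) hp
    simp at this
    linear_combination -this
  have hd : ∀ x : ℝ, HasDerivAt
      (fun x => (1 - x ^ 2) ^ (k + 1) * ((derivative p).eval x * q.eval x))
      ((1 - x ^ 2) ^ (k + 1) * ((derivative p).eval x * (derivative q).eval x)
        - (lam - k * (k + 1)) * ((1 - x ^ 2) ^ k * (p.eval x * q.eval x))) x := by
    intro x
    have h1 : HasDerivAt (fun x : ℝ => 1 - x ^ 2) (-(2 * x)) x := by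
      simpa using (hasDerivAt_pow 2 x).const_sub 1
    have h2 := (h1.pow (k + 1)).mul (((derivative p).hasDerivAt x).mul (q.hasDerivAt x))
    refine h2.congr_deriv ?_
    simp only [Pi.pow_apply, Pi.mul_apply, Nat.add_sub_cancel]
    push_cast
    linear_combination (1 - x ^ 2) ^ k * q.eval x * hode x
  have hc1 : Continuous fun x : ℝ =>
      (1 - x ^ 2) ^ (k + 1) * ((derivative p).eval x * (derivative q).eval x) := by fun_prop
  have hc2 : Continuous fun x : ℝ =>
      (lam - k * (k + 1)) * ((1 - x ^ 2) ^ k * (p.eval x * q.eval x)) := by fun_prop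
  have := intervalIntegral.integral_eq_sub_of_hasDerivAt (a := -1) (b := 1) (fun x _ => hd x)
    ((hc1.sub hc2).intervalIntegrable _ _)
  rw [intervalIntegral.integral_sub (hc1.intervalIntegrable _ _) (hc2.intervalIntegrable _ _),
    intervalIntegral.integral_const_mul] at this
  simp at this
  unfold gegIntegral
  linarith

/-- Applying `gegIntegral_derivative` to either factor gives the same left side, so the pairing
times the difference of the eigenvalues is zero. -/
lemma gegIntegral_legendre_of_ne {l l' : ℕ} (h : l ≠ l') (m : ℕ) :
    gegIntegral m (Polynomial.derivative^[m] (legendrePoly l))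
      (Polynomial.derivative^[m] (legendrePoly l')) = 0 := by
  have h1 := gegIntegral_derivative m _ _ (Polynomial.derivative^[m] (legendrePoly l'))
    (gegenbauerODE_legendre l m)
  have h2 := gegIntegral_derivative m _ _ (Polynomial.derivative^[m] (legendrePoly l))
    (gegenbauerODE_legendre l' m)
  rw [gegIntegral_comm, gegIntegral_comm m] at h2
  rw [h1] at h2
  have h3 : ((l : ℝ) * (l + 1) - l' * (l' + 1)) ≠ 0 := by
    have : ((l : ℝ) * (l + 1) - l' * (l' + 1)) = (l - l') * (l + l' + 1) := by ring
    rw [this]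
    refine mul_ne_zero (sub_ne_zero.mpr (by exact_mod_cast h)) (by positivity)
  refine (mul_eq_zero.mp (?_ : ((l : ℝ) * (l + 1) - l' * (l' + 1)) * _ = 0)).resolve_left h3
  linear_combination h2

/-- Each derivative contributes the factor `l(l+1) - m(m+1) = (l-m)(l+m+1)`, and the product
telescopes to the factorials. -/
lemma gegIntegral_legendre_self_mul (l m : ℕ) (hm : m ≤ l) :
    gegIntegral m (Polynomial.derivative^[m] (legendrePoly l))
      (Polynomial.derivative^[m] (legendrePoly l)) * ((l - m).factorial : ℝ)
      = ((l + m).factorial : ℝ) * gegIntegral 0 (legendrePoly l) (legendrePoly l) := by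
  induction m with
  | zero => simp [mul_comm]
  | succ m ih =>
    have h1 := gegIntegral_derivative m _ _ (Polynomial.derivative^[m] (legendrePoly l))
      (gegenbauerODE_legendre l m)
    have ih := ih (by omega)
    rw [Function.iterate_succ_apply', h1]
    obtain ⟨d, rfl⟩ := Nat.exists_eq_add_of_le hm
    rw [show m + 1 + d - m = d + 1 by omega, Nat.factorial_succ] at ih
    rw [show m + 1 + d - (m + 1) = d by omega,
      show m + 1 + d + (m + 1) = (m + 1 + d + m) + 1 by omega, Nat.factorial_succ]
    push_cast at ih ⊢
    linear_combination ((m : ℝ) + 1 + d + m + 1) * ih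

/-- The derivative of `x (1 - x²)^(l+1)` has integral zero, which gives `(2l+3) J_{l+1} = (2l+2)
J_l`. -/
lemma integral_one_sub_sq_pow (l : ℕ) :
    (∫ x in (-1 : ℝ)..1, (1 - x ^ 2) ^ l) * ((2 * l + 1).factorial : ℝ)
      = 2 ^ (2 * l + 1) * (l.factorial : ℝ) ^ 2 := by
  induction l with
  | zero => norm_num
  | succ l ih =>
    have hd : ∀ x : ℝ, HasDerivAt (fun x => x * (1 - x ^ 2) ^ (l + 1))
        ((2 * l + 3) * (1 - x ^ 2) ^ (l + 1) - (2 * l + 2) * (1 - x ^ 2) ^ l) x := by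
      intro x
      have h1 : HasDerivAt (fun x : ℝ => 1 - x ^ 2) (-(2 * x)) x := by
        simpa using (hasDerivAt_pow 2 x).const_sub 1
      refine ((hasDerivAt_id x).mul (h1.pow (l + 1))).congr_deriv ?_
      simp only [Pi.pow_apply, id, Nat.add_sub_cancel]
      push_cast
      ring
    have := intervalIntegral.integral_eq_sub_of_hasDerivAt (a := -1) (b := 1) (fun x _ => hd x)
      (Continuous.intervalIntegrable (by fun_prop) _ _)
    rw [intervalIntegral.integral_sub (Continuous.intervalIntegrable (by fun_prop) _ _)
      (Continuous.intervalIntegrable (by fun_prop) _ _),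
      intervalIntegral.integral_const_mul, intervalIntegral.integral_const_mul] at this
    simp at this
    rw [show 2 * (l + 1) + 1 = (2 * l + 1) + 1 + 1 by ring, Nat.factorial_succ (2 * l + 1 + 1),
      Nat.factorial_succ (2 * l + 1), Nat.factorial_succ l]
    push_cast
    linear_combination (2 * (l : ℝ) + 2) * ((2 * l + 1).factorial : ℝ) * this
      + (2 * (l : ℝ) + 2) ^ 2 * ih

/-- Read the telescoped recursion backwards from `m = l`: there `D^l P_l` is a constant and only the
integral of `(1 - x²)^l` remains. -/
lemma gegIntegral_legendrePoly_self (l : ℕ) :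
    gegIntegral 0 (legendrePoly l) (legendrePoly l) = 2 / (2 * l + 1) := by
  have h1 := gegIntegral_legendre_self_mul l l le_rfl
  have hC : Polynomial.derivative^[l] (legendrePoly l)
      = Polynomial.C ((l.factorial : ℝ) * (1 / (2 ^ l * (l.factorial : ℝ)) *
          ((2 * l).descFactorial l : ℕ))) := by
    have hdeg := natDegree_iterate_derivative_legendrePoly_le l l
    rw [Nat.sub_self] at hdeg
    rw [Polynomial.eq_C_of_natDegree_le_zero hdeg]
    have := coeff_iterate_derivative_legendrePoly l l le_rfl
    rw [Nat.sub_self] at this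
    rw [this, Nat.descFactorial_self]
  have hf : ((l.factorial : ℕ) : ℝ) * ((2 * l).descFactorial l : ℕ) = ((2 * l).factorial : ℝ) := by
    have := Nat.factorial_mul_descFactorial (show l ≤ 2 * l by omega)
    rw [show 2 * l - l = l by omega] at this
    exact_mod_cast this
  have h2 := integral_one_sub_sq_pow l
  rw [hC] at h1
  simp only [gegIntegral, Polynomial.eval_C, intervalIntegral.integral_mul_const, Nat.sub_self,
    Nat.factorial_zero, Nat.cast_one, mul_one, pow_zero, one_mul, ← two_mul] at h1 ⊢
  rw [Nat.factorial_succ] at h2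
  set J := ∫ x in (-1 : ℝ)..1, (1 - x ^ 2) ^ l
  set A : ℝ := (((2 * l).descFactorial l : ℕ) : ℝ)
  have hl : (l.factorial : ℝ) ≠ 0 := by positivity
  have hl2 : ((2 * l).factorial : ℝ) ≠ 0 := by positivity
  have hl3 : (2 * (l : ℝ) + 1) ≠ 0 := by positivity
  push_cast at h2
  rw [← hf] at h1 h2 hl2
  have hA : A ≠ 0 := right_ne_zero_of_mul hl2
  field_simp at h1 h2 ⊢
  have h3 : (l.factorial : ℝ) * (2 ^ l) ^ 2 ≠ 0 := by positivity
  rw [← mul_right_inj' h3]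
  ring_nf at h1 h2 ⊢
  linear_combination (-1 - 2 * (l : ℝ)) * h1 + h2

/-- The normalization of the associated Legendre functions. -/
lemma gegIntegral_legendre_self (l m : ℕ) (hm : m ≤ l) :
    gegIntegral m (Polynomial.derivative^[m] (legendrePoly l))
      (Polynomial.derivative^[m] (legendrePoly l))
      = 2 / (2 * l + 1) * ((l + m).factorial / (l - m).factorial) := by
  have h := gegIntegral_legendre_self_mul l m hm
  rw [gegIntegral_legendrePoly_self] at h
  have : ((l - m).factorial : ℝ) ≠ 0 := by positivity
  field_simp at h ⊢
  linarith

/-! ### The surface measure in spherical coordinates -/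

lemma ae_angleMeasure_mem_rectangle :
    ∀ᵐ p ∂angleMeasure, p ∈ Icc 0 Real.pi ×ˢ Ico 0 (2 * Real.pi) :=
  (withDensity_absolutelyContinuous _ _).ae_le
    (ae_restrict_mem (measurableSet_Icc.prod measurableSet_Ico))

/-- The density `sin θ` vanishes at the poles. Away from them `sphPoint` is injective and the
singular coefficients of `sphLaplacian` are harmless. -/
lemma ae_angleMeasure_mem_Ioo :
    ∀ᵐ p ∂angleMeasure, p ∈ Ioo 0 Real.pi ×ˢ Ico 0 (2 * Real.pi) := by
  have h : ∀ᵐ p ∂angleMeasure, Real.sin p.1 ≠ 0 := by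
    have hm : Measurable fun p : ℝ × ℝ => ENNReal.ofReal (Real.sin p.1) := by fun_prop
    rw [angleMeasure, ae_withDensity_iff hm]
    refine Filter.Eventually.of_forall fun p hp h0 => hp (by simp [h0])
  filter_upwards [h, ae_angleMeasure_mem_rectangle] with p h1 h2
  refine ⟨⟨lt_of_le_of_ne h2.1.1 ?_, lt_of_le_of_ne h2.1.2 ?_⟩, h2.2⟩
  · intro h; exact h1 (by rw [← h, Real.sin_zero])
  · intro h; exact h1 (by rw [h, Real.sin_pi])

instance isFiniteMeasure_angleMeasure : IsFiniteMeasure angleMeasure := by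
  have : IsFiniteMeasure ((volume : Measure (ℝ × ℝ)).restrict
      (Icc 0 Real.pi ×ˢ Ico 0 (2 * Real.pi))) := by
    constructor
    rw [Measure.restrict_apply_univ, Measure.volume_eq_prod, Measure.prod_prod]
    simp [ENNReal.mul_lt_top]
  refine isFiniteMeasure_withDensity_ofReal (Integrable.hasFiniteIntegral ?_)
  exact Integrable.of_bound (by fun_prop) 1
    (Filter.Eventually.of_forall fun p => by simpa using Real.abs_sin_le_one p.1)

lemma memLp_angleMeasure_of_continuous {E : Type*} [NormedAddCommGroup E]
    [SecondCountableTopologyEither (ℝ × ℝ) E] {F : ℝ × ℝ → E} (hF : Continuous F) (q : ENNReal) :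
    MemLp F q angleMeasure := by
  obtain ⟨C, hC⟩ := (isCompact_Icc.prod isCompact_Icc :
    IsCompact (Icc 0 Real.pi ×ˢ Icc 0 (2 * Real.pi))).exists_bound_of_continuousOn hF.continuousOn
  refine MemLp.of_bound hF.aestronglyMeasurable C ?_
  filter_upwards [ae_angleMeasure_mem_rectangle] with p hp
  exact hC p ⟨hp.1, Ico_subset_Icc_self hp.2⟩

lemma integral_angleMeasure_mul (F G : ℝ → ℂ) :
    ∫ p, F p.1 * G p.2 ∂angleMeasure
      = (∫ t in (0 : ℝ)..Real.pi, (Real.sin t : ℂ) * F t) * ∫ s in (0 : ℝ)..(2 * Real.pi), G s := by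
  have hm : Measurable fun p : ℝ × ℝ => ENNReal.ofReal (Real.sin p.1) := by fun_prop
  rw [angleMeasure, integral_withDensity_eq_integral_toReal_smul hm (by simp)]
  have h1 : ∫ p in Icc 0 Real.pi ×ˢ Ico 0 (2 * Real.pi),
      (ENNReal.ofReal (Real.sin p.1)).toReal • (F p.1 * G p.2)
      = ∫ p in Icc 0 Real.pi ×ˢ Ico 0 (2 * Real.pi), ((Real.sin p.1 : ℂ) * F p.1) * G p.2 := by
    refine setIntegral_congr_fun (measurableSet_Icc.prod measurableSet_Ico) fun p hp => ?_
    simp only [ENNReal.toReal_ofReal (Real.sin_nonneg_of_mem_Icc hp.1), Complex.real_smul]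
    ring
  rw [h1, Measure.volume_eq_prod,
    setIntegral_prod_mul (fun t => (Real.sin t : ℂ) * F t) G, integral_Icc_eq_integral_Ioc,
    integral_Ico_eq_integral_Ioo, ← integral_Ioc_eq_integral_Ioo,
    intervalIntegral.integral_of_le Real.pi_pos.le,
    intervalIntegral.integral_of_le (by positivity)]

/-! ### Orthonormality of the spherical harmonics -/

/-- The polynomial `D^k P_l`. -/
def legendreDeriv (l k : ℕ) : Polynomial ℝ := Polynomial.derivative^[k] (legendrePoly l)

/-- The normalizing factor of the spherical harmonics of degree `l` and order `± k`. -/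
def sphAmp (l k : ℕ) : ℝ :=
  Real.sqrt ((2 * l + 1) / (4 * Real.pi) * ((l - k).factorial / (l + k).factorial))

/-- The spherical harmonic of degree `l` and order `m` up to its sign. -/
def unsignedHarmonic (l : ℕ) (m : ℤ) (p : ℝ × ℝ) : ℂ :=
  (sphAmp l m.natAbs * (Real.sin p.1 ^ m.natAbs * (legendreDeriv l m.natAbs).eval (Real.cos p.1)) : ℝ)
    * Complex.exp (Complex.I * m * p.2)

/-- The sign in `sphHarmonic`. -/
def harmonicSign (m : ℤ) : ℝ := if 0 ≤ m then 1 else (-1) ^ m.natAbs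

lemma harmonicSign_mul_self (m : ℤ) : harmonicSign m * harmonicSign m = 1 := by
  unfold harmonicSign
  split_ifs
  · simp
  · rw [← pow_add, ← two_mul, pow_mul]; simp

/-- The sign conventions collapse to one unimodular factor, invisible in `|a_{lm}|²`. For negative
order the ratio of factorials is absorbed into the square root, which inverts the ratio there. -/
lemma sphHarmonic_eq {l : ℕ} {m : ℤ} (hm : m ∈ Finset.Icc (-(l : ℤ)) l) {p : ℝ × ℝ}
    (hp : p.1 ∈ Icc 0 Real.pi) :
    sphHarmonic l m p = (harmonicSign m : ℂ) * unsignedHarmonic l m p := by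
  rw [Finset.mem_Icc] at hm
  have hsin : Real.sqrt (1 - Real.cos p.1 ^ 2) = Real.sin p.1 := by
    rw [← Real.abs_sin_eq_sqrt_one_sub_cos_sq, abs_of_nonneg (Real.sin_nonneg_of_mem_Icc hp)]
  have key : sphNorm l m * assocLegendre l m (Real.cos p.1)
      = harmonicSign m * (sphAmp l m.natAbs *
        (Real.sin p.1 ^ m.natAbs * (legendreDeriv l m.natAbs).eval (Real.cos p.1))) := by
    have hsq (k : ℕ) : ((-1 : ℝ) ^ k) * (-1) ^ k = 1 := by
      rw [← pow_add, ← two_mul, pow_mul]; simp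
    rcases le_or_gt 0 m with h0 | h0
    · obtain ⟨k, rfl⟩ := Int.eq_ofNat_of_zero_le h0
      simp only [sphNorm, assocLegendre, assocLegendreNat, harmonicSign, sphAmp, legendreDeriv, h0,
        if_true, Int.natAbs_natCast, Int.toNat_natCast, hsin,
        show ((l : ℤ) - k).toNat = l - k by omega, show ((l : ℤ) + k).toNat = l + k by omega]
      linear_combination (Real.sqrt ((2 * l + 1) / (4 * Real.pi) *
        ((l - k).factorial / (l + k).factorial)) * (Real.sin p.1 ^ k *
        (Polynomial.derivative^[k] (legendrePoly l)).eval (Real.cos p.1))) * hsq k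
    · obtain ⟨k, hk⟩ := Int.eq_ofNat_of_zero_le (show 0 ≤ -m by omega)
      obtain rfl : m = -(k : ℤ) := by omega
      have hneg : ¬ (0 ≤ -(k : ℤ)) := by omega
      simp only [sphNorm, assocLegendre, assocLegendreNat, harmonicSign, sphAmp, legendreDeriv, hneg,
        if_false, Int.natAbs_neg, Int.natAbs_natCast, hsin,
        show ((l : ℤ) - -(k : ℤ)).toNat = l + k by omega,
        show ((l : ℤ) + -(k : ℤ)).toNat = l - k by omega]
      have h1 : ((l - k).factorial : ℝ) ≠ 0 := by positivity
      have h2 : ((l + k).factorial : ℝ) ≠ 0 := by positivity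
      have hs : Real.sqrt ((2 * l + 1) / (4 * Real.pi) * ((l + k).factorial / (l - k).factorial))
          * ((l - k).factorial / (l + k).factorial)
          = Real.sqrt ((2 * l + 1) / (4 * Real.pi) * ((l - k).factorial / (l + k).factorial)) := by
        have h3 : (0 : ℝ) ≤ (l - k).factorial / (l + k).factorial := by positivity
        rw [← Real.sqrt_sq h3, ← Real.sqrt_mul (by positivity), Real.sqrt_sq h3]
        congr 1
        field_simp
      rw [← hs]
      linear_combination (Real.sqrt ((2 * l + 1) / (4 * Real.pi) *
        ((l + k).factorial / (l - k).factorial)) * ((l - k).factorial / (l + k).factorial) *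
        (-1) ^ k * (Real.sin p.1 ^ k *
        (Polynomial.derivative^[k] (legendrePoly l)).eval (Real.cos p.1))) * hsq k
  unfold sphHarmonic unsignedHarmonic
  have key' := congrArg (fun x : ℝ => (x : ℂ)) key
  push_cast at key' ⊢
  linear_combination Complex.exp (Complex.I * m * p.2) * key'

lemma continuous_unsignedHarmonic (l : ℕ) (m : ℤ) : Continuous (unsignedHarmonic l m) := by
  unfold unsignedHarmonic
  fun_prop

lemma integral_exp_int (n : ℤ) :
    ∫ s in (0 : ℝ)..(2 * Real.pi), Complex.exp (Complex.I * n * s)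
      = if n = 0 then (2 * Real.pi : ℂ) else 0 := by
  split_ifs with h
  · simp [h]
  · have hc : Complex.I * (n : ℂ) ≠ 0 := by simp [h]
    rw [integral_exp_mul_complex hc]
    have : Complex.exp (Complex.I * n * ((2 * Real.pi : ℝ) : ℂ)) = 1 := by
      rw [← Complex.exp_int_mul_two_pi_mul_I n]
      congr 1
      push_cast
      ring
    rw [this]
    simp

lemma integral_sin_mul_legendreDeriv (l l' k : ℕ) :
    ∫ t in (0 : ℝ)..Real.pi, Real.sin t * ((Real.sin t ^ k * (legendreDeriv l k).eval (Real.cos t)) *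
        (Real.sin t ^ k * (legendreDeriv l' k).eval (Real.cos t)))
      = gegIntegral k (legendreDeriv l k) (legendreDeriv l' k) := by
  have h := intervalIntegral.integral_comp_mul_deriv (a := 0) (b := Real.pi) (f := Real.cos)
    (f' := fun t => -Real.sin t)
    (g := fun x => (1 - x ^ 2) ^ k * ((legendreDeriv l k).eval x * (legendreDeriv l' k).eval x))
    (fun x _ => Real.hasDerivAt_cos x) (by fun_prop) (by fun_prop)
  rw [Real.cos_zero, Real.cos_pi, intervalIntegral.integral_symm (-1) 1] at h
  unfold gegIntegral
  rw [eq_comm, ← neg_inj, ← h, ← intervalIntegral.integral_neg]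
  refine intervalIntegral.integral_congr fun t _ => ?_
  have hs : 1 - Real.cos t ^ 2 = Real.sin t ^ 2 := by rw [Real.sin_sq]
  simp only [Function.comp, hs]
  ring

/-- The integral over `φ` forces `m = m'`; what remains is a Legendre pairing of common order `|m|`.
-/
lemma integral_unsignedHarmonic_mul_conj {l l' : ℕ} {m m' : ℤ} (hm : m ∈ Finset.Icc (-(l : ℤ)) l) :
    ∫ p, (starRingEnd ℂ) (unsignedHarmonic l' m' p) * unsignedHarmonic l m p ∂angleMeasure
      = if l = l' ∧ m = m' then 1 else 0 := by
  rw [Finset.mem_Icc] at hm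
  set R : ℕ → ℤ → ℝ → ℝ := fun l m t => sphAmp l m.natAbs *
    (Real.sin t ^ m.natAbs * (legendreDeriv l m.natAbs).eval (Real.cos t)) with hR
  have h1 : ∀ p, (starRingEnd ℂ) (unsignedHarmonic l' m' p) * unsignedHarmonic l m p
      = ((R l m p.1 * R l' m' p.1 : ℝ) : ℂ) * Complex.exp (Complex.I * ((m - m' : ℤ) : ℂ) * p.2) := by
    intro p
    have : Complex.exp (Complex.I * ((m - m' : ℤ) : ℂ) * p.2)
        = Complex.exp (Complex.I * m * p.2) * (starRingEnd ℂ) (Complex.exp (Complex.I * m' * p.2)) := by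
      rw [← Complex.exp_conj, ← Complex.exp_add]
      congr 1
      simp
      ring
    rw [this]
    simp only [unsignedHarmonic, map_mul, Complex.conj_ofReal, hR]
    push_cast
    ring
  simp_rw [h1]
  rw [integral_angleMeasure_mul (fun t => ((R l m t * R l' m' t : ℝ) : ℂ))
    (fun s => Complex.exp (Complex.I * ((m - m' : ℤ) : ℂ) * s)), integral_exp_int]
  by_cases hmm : m = m'
  · subst hmm
    have h2 : ∫ t in (0 : ℝ)..Real.pi, (Real.sin t : ℂ) * ((R l m t * R l' m t : ℝ) : ℂ)
        = ((sphAmp l m.natAbs * sphAmp l' m.natAbs * gegIntegral m.natAbs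
          (legendreDeriv l m.natAbs) (legendreDeriv l' m.natAbs) : ℝ) : ℂ) := by
      rw [← integral_sin_mul_legendreDeriv, ← intervalIntegral.integral_const_mul,
        ← intervalIntegral.integral_ofReal]
      refine intervalIntegral.integral_congr fun t _ => ?_
      simp only [hR]
      push_cast
      ring
    rw [h2]
    by_cases hl : l = l'
    · subst hl
      have hk : m.natAbs ≤ l := by omega
      simp only [sub_self, and_self, if_true]
      unfold legendreDeriv
      rw [gegIntegral_legendre_self l _ hk, sphAmp, Real.mul_self_sqrt (by positivity)]
      have h3 : ((l - m.natAbs).factorial : ℝ) ≠ 0 := by positivity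
      have h4 : ((l + m.natAbs).factorial : ℝ) ≠ 0 := by positivity
      rw [← Complex.ofReal_ofNat, ← Complex.ofReal_mul, ← Complex.ofReal_mul, ← Complex.ofReal_one]
      congr 1
      field_simp
      ring
    · simp [hl, legendreDeriv, gegIntegral_legendre_of_ne hl]
  · simp [hmm, sub_eq_zero]

/-! ### Completeness of the spherical harmonics -/

lemma continuous_sphPoint : Continuous sphPoint := by
  unfold sphPoint
  refine Continuous.subtype_mk ?_ _
  refine (PiLp.continuous_toLp 2 _).comp (continuous_pi fun i => ?_)
  fin_cases i <;> simp <;> fun_prop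

lemma injOn_sphPoint : InjOn sphPoint (Ioo 0 Real.pi ×ˢ Ico 0 (2 * Real.pi)) := by
  rintro ⟨t, s⟩ ⟨ht, hs⟩ ⟨t', s'⟩ ⟨ht', hs'⟩ h
  simp only at ht hs ht' hs'
  have hval : ∀ i : Fin 3, (sphPoint (t, s) : E3) i = (sphPoint (t', s') : E3) i := by rw [h]; simp
  have h0 : Real.cos t = Real.cos t' := hval 0
  have h1 : Real.sin t * Real.cos s = Real.sin t' * Real.cos s' := hval 1
  have h2 : Real.sin t * Real.sin s = Real.sin t' * Real.sin s' := hval 2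
  obtain rfl : t = t' :=
    Real.injOn_cos (Ioo_subset_Icc_self ht) (Ioo_subset_Icc_self ht') h0
  have hsin := (Real.sin_pos_of_mem_Ioo ht).ne'
  have h3 := Real.Angle.cos_sin_inj (mul_left_cancel₀ hsin h1) (mul_left_cancel₀ hsin h2)
  obtain ⟨k, hk⟩ := Real.Angle.angle_eq_iff_two_pi_dvd_sub.mp h3
  have hk0 : k = 0 := by
    have hpi := Real.pi_pos
    have hlt : (k : ℝ) < 1 := by
      by_contra! hcon
      nlinarith [hs.2, hs'.1]
    have hgt : (-1 : ℝ) < k := by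
      by_contra! hcon
      nlinarith [hs.1, hs'.2]
    have h5 : k < 1 := by exact_mod_cast hlt
    have h6 : -1 < k := by exact_mod_cast hgt
    omega
  rw [hk0] at hk
  have : s = s' := by simpa [sub_eq_zero] using hk
  rw [this]

/-- A measure that is absolutely continuous with respect to the surface measure is determined by
its image on the sphere. -/
lemma eq_of_map_sphPoint_eq {ν ν' : Measure (ℝ × ℝ)} (hν : ν ≪ angleMeasure)
    (hν' : ν' ≪ angleMeasure) (h : ν.map sphPoint = ν'.map sphPoint) : ν = ν' := by
  set S : Set (ℝ × ℝ) := Ioo 0 Real.pi ×ˢ Ico 0 (2 * Real.pi)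
  have hS : MeasurableSet S := measurableSet_Ioo.prod measurableSet_Ico
  ext B hB
  -- An injective continuous image of a Borel set is Borel (Lusin–Souslin).
  have himg : MeasurableSet (sphPoint '' (B ∩ S)) :=
    (hB.inter hS).image_of_continuousOn_injOn continuous_sphPoint.continuousOn
      (injOn_sphPoint.mono inter_subset_right)
  have key : ∀ κ : Measure (ℝ × ℝ), κ ≪ angleMeasure →
      κ B = κ.map sphPoint (sphPoint '' (B ∩ S)) := by
    intro κ hκ
    rw [Measure.map_apply continuous_sphPoint.measurable himg]
    refine measure_congr ?_
    filter_upwards [hκ.ae_le ae_angleMeasure_mem_Ioo] with p hp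
    refine propext ⟨fun hpB => ⟨p, ⟨hpB, hp⟩, rfl⟩, ?_⟩
    rintro ⟨q, ⟨hqB, hqS⟩, hq⟩
    rwa [← injOn_sphPoint hqS hp hq]
  rw [key ν hν, key ν' hν', h]

/-- The functions `x₀` and `x₁ + i x₂` on the sphere. -/
def sphCoord (j : Bool) : BoundedContinuousFunction Sphere2 ℂ :=
  BoundedContinuousFunction.mkOfCompact
    ⟨fun x => if j then (((x : E3) 0 : ℝ) : ℂ)
      else (((x : E3) 1 : ℝ) : ℂ) + Complex.I * (((x : E3) 2 : ℝ) : ℂ), by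
      cases j <;> simp <;> fun_prop⟩

lemma sphCoord_true_sphPoint (p : ℝ × ℝ) : sphCoord true (sphPoint p) = (Real.cos p.1 : ℂ) := by
  simp [sphCoord, sphPoint]

lemma sphCoord_false_sphPoint (p : ℝ × ℝ) :
    sphCoord false (sphPoint p) = (Real.sin p.1 : ℂ) * Complex.exp (Complex.I * p.2) := by
  rw [mul_comm Complex.I, Complex.exp_mul_I]
  simp [sphCoord, sphPoint]
  ring

/-- The algebra of polynomial functions on the sphere. -/
def sphPolynomials : StarSubalgebra ℂ (BoundedContinuousFunction Sphere2 ℂ) :=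
  StarAlgebra.adjoin ℂ (range sphCoord)

lemma separatesPoints_sphPolynomials :
    (sphPolynomials.map (BoundedContinuousFunction.toContinuousMapStarₐ ℂ)).SeparatesPoints := by
  intro x y hxy
  by_contra! hcon
  have hmem : ∀ j, sphCoord j x = sphCoord j y := by
    intro j
    refine hcon _ ⟨_, ?_, rfl⟩
    exact ⟨sphCoord j, StarAlgebra.subset_adjoin ℂ _ ⟨j, rfl⟩, rfl⟩
  have h0 := hmem true
  have h1 := congrArg Complex.re (hmem false)
  have h2 := congrArg Complex.im (hmem false)
  simp [sphCoord] at h0 h1 h2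
  refine hxy (Subtype.ext (PiLp.ext fun i => ?_))
  fin_cases i
  exacts [h0, h1, h2]

lemma exists_monomial_of_mem_closure {g : BoundedContinuousFunction Sphere2 ℂ}
    (hg : g ∈ Submonoid.closure (range sphCoord ∪ star (range sphCoord))) :
    ∃ a b c : ℕ, ∀ x, g x = sphCoord true x ^ a * sphCoord false x ^ b *
      (starRingEnd ℂ) (sphCoord false x) ^ c := by
  induction hg using Submonoid.closure_induction with
  | one => exact ⟨0, 0, 0, fun x => by simp⟩
  | mul g₁ g₂ _ _ h₁ h₂ =>
    obtain ⟨a, b, c, h⟩ := h₁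
    obtain ⟨a', b', c', h'⟩ := h₂
    refine ⟨a + a', b + b', c + c', fun x => ?_⟩
    rw [BoundedContinuousFunction.mul_apply, h, h']
    ring
  | mem g hg =>
    have hreal : ∀ x, (starRingEnd ℂ) (sphCoord true x) = sphCoord true x := by
      intro x; simp [sphCoord]
    rcases hg with ⟨j, rfl⟩ | ⟨j, hj⟩
    · cases j
      · exact ⟨0, 1, 0, fun x => by simp⟩
      · exact ⟨1, 0, 0, fun x => by simp⟩
    · have hx : ∀ x, g x = (starRingEnd ℂ) (sphCoord j x) := by
        intro x
        rw [hj]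
        simp
      cases j
      · exact ⟨0, 0, 1, fun x => by rw [hx]; simp⟩
      · exact ⟨1, 0, 0, fun x => by rw [hx, hreal]; simp⟩

/-- A function `sin^|m| θ P(cos θ) exp(i m φ)`. -/
def zonalFun (m : ℤ) (P : Polynomial ℝ) (p : ℝ × ℝ) : ℂ :=
  ((Real.sin p.1 ^ m.natAbs * P.eval (Real.cos p.1) : ℝ) : ℂ) * Complex.exp (Complex.I * m * p.2)

lemma continuous_zonalFun (m : ℤ) (P : Polynomial ℝ) : Continuous (zonalFun m P) := by
  unfold zonalFun
  fun_prop

/-- The power `sin^(b+c)` exceeds `sin^|b-c|` by an even exponent, and `sin² = 1 - cos²` makes the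
excess a polynomial in `cos θ`. So every monomial has the shape spanned by the harmonics of order `b
- c`. -/
lemma monomial_sphPoint (a b c : ℕ) (p : ℝ × ℝ) :
    sphCoord true (sphPoint p) ^ a * sphCoord false (sphPoint p) ^ b *
      (starRingEnd ℂ) (sphCoord false (sphPoint p)) ^ c
      = zonalFun ((b : ℤ) - c) (Polynomial.X ^ a * (1 - Polynomial.X ^ 2) ^ (min b c)) p := by
  rw [sphCoord_true_sphPoint, sphCoord_false_sphPoint]
  have hexp : (starRingEnd ℂ) (Complex.exp (Complex.I * p.2)) = Complex.exp (-(Complex.I * p.2)) := by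
    rw [← Complex.exp_conj]; simp
  have hs : (1 : ℝ) - Real.cos p.1 ^ 2 = Real.sin p.1 ^ 2 := by rw [Real.sin_sq]
  have hpow : Real.sin p.1 ^ (b + c)
      = Real.sin p.1 ^ ((b : ℤ) - c).natAbs * (Real.sin p.1 ^ 2) ^ (min b c) := by
    rw [← pow_mul, ← pow_add]
    congr 1
    omega
  have he : Complex.exp (Complex.I * p.2) ^ b * Complex.exp (-(Complex.I * p.2)) ^ c
      = Complex.exp (Complex.I * ((b : ℤ) - c : ℤ) * p.2) := by
    rw [← Complex.exp_nat_mul, ← Complex.exp_nat_mul, ← Complex.exp_add]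
    congr 1
    push_cast
    ring
  simp only [zonalFun, map_mul, Complex.conj_ofReal, hexp, Polynomial.eval_mul, Polynomial.eval_pow,
    Polynomial.eval_X, Polynomial.eval_sub, Polynomial.eval_one, hs]
  rw [← he, mul_left_comm (Real.sin p.1 ^ _), ← hpow]
  push_cast
  ring

section Completeness

variable {f : ℝ × ℝ → ℂ}

lemma integrable_mul_of_continuous (hf : MemLp f 2 angleMeasure) {F : ℝ × ℝ → ℂ}
    (hF : Continuous F) : Integrable (fun p => f p * F p) angleMeasure :=
  hf.integrable_mul (memLp_angleMeasure_of_continuous hF 2)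

/-- By linearity in `P` it suffices to treat the spanning family `D^|m| P_{n+|m|}`, for which the
function is a multiple of a harmonic. -/
lemma integral_mul_zonalFun_eq_zero (hf : MemLp f 2 angleMeasure)
    (h : ∀ l : ℕ, ∀ m ∈ Finset.Icc (-(l : ℤ)) l, ∫ p, f p * unsignedHarmonic l m p ∂angleMeasure = 0)
    (m : ℤ) (P : Polynomial ℝ) : ∫ p, f p * zonalFun m P p ∂angleMeasure = 0 := by
  have hP : P ∈ Submodule.span ℝ
      (range fun n => Polynomial.derivative^[m.natAbs] (legendrePoly (n + m.natAbs))) := by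
    rw [span_iterate_derivative_legendrePoly]; trivial
  induction hP using Submodule.span_induction with
  | mem P hP =>
    obtain ⟨n, rfl⟩ := hP
    have h1 := h (n + m.natAbs) m (by rw [Finset.mem_Icc]; omega)
    have hA : (sphAmp (n + m.natAbs) m.natAbs : ℂ) ≠ 0 := by
      rw [Complex.ofReal_ne_zero]
      unfold sphAmp
      positivity
    refine (mul_eq_zero.mp ?_).resolve_left hA
    rw [← integral_const_mul, ← h1]
    refine integral_congr_ae (Filter.Eventually.of_forall fun p => ?_)
    simp only [zonalFun, unsignedHarmonic, legendreDeriv]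
    push_cast
    ring
  | zero => simp [zonalFun]
  | add P Q _ _ hP hQ =>
    have : ∀ p, f p * zonalFun m (P + Q) p = f p * zonalFun m P p + f p * zonalFun m Q p := by
      intro p
      simp only [zonalFun, Polynomial.eval_add]
      push_cast
      ring
    simp_rw [this]
    rw [integral_add (integrable_mul_of_continuous hf (continuous_zonalFun _ _))
      (integrable_mul_of_continuous hf (continuous_zonalFun _ _)), hP, hQ, add_zero]
  | smul r P _ hP =>
    have : ∀ p, f p * zonalFun m (r • P) p = (r : ℂ) * (f p * zonalFun m P p) := by
      intro p
      simp only [zonalFun, Polynomial.eval_smul, smul_eq_mul]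
      push_cast
      ring
    simp_rw [this]
    rw [integral_const_mul, hP, mul_zero]

lemma integral_mul_sphPolynomial_eq_zero (hf : MemLp f 2 angleMeasure)
    (h : ∀ l : ℕ, ∀ m ∈ Finset.Icc (-(l : ℤ)) l, ∫ p, f p * unsignedHarmonic l m p ∂angleMeasure = 0)
    {g : BoundedContinuousFunction Sphere2 ℂ} (hg : g ∈ sphPolynomials) :
    ∫ p, f p * g (sphPoint p) ∂angleMeasure = 0 := by
  have hint : ∀ g : BoundedContinuousFunction Sphere2 ℂ,
      Integrable (fun p => f p * g (sphPoint p)) angleMeasure := fun g =>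
    integrable_mul_of_continuous hf (g.continuous.comp continuous_sphPoint)
  have hg' : g ∈ Submodule.span ℂ (Submonoid.closure
      (range sphCoord ∪ star (range sphCoord)) : Set (BoundedContinuousFunction Sphere2 ℂ)) := by
    rw [← Algebra.adjoin_eq_span]
    exact hg
  clear hg
  induction hg' using Submodule.span_induction with
  | mem g hg =>
    obtain ⟨a, b, c, habc⟩ := exists_monomial_of_mem_closure hg
    simp_rw [habc, monomial_sphPoint]
    exact integral_mul_zonalFun_eq_zero hf h _ _
  | zero => simp
  | add g₁ g₂ _ _ h₁ h₂ =>
    simp only [BoundedContinuousFunction.add_apply, mul_add]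
    rw [integral_add (hint _) (hint _), h₁, h₂, add_zero]
  | smul r g _ hg =>
    simp only [BoundedContinuousFunction.coe_smul, smul_eq_mul, mul_left_comm _ r]
    rw [integral_const_mul, hg, mul_zero]

end Completeness

/-- Completeness of the spherical harmonics, for real functions. -/
lemma ae_eq_zero_of_integral_unsignedHarmonic_eq_zero {f : ℝ × ℝ → ℝ} (hf : MemLp f 2 angleMeasure)
    (h : ∀ l : ℕ, ∀ m ∈ Finset.Icc (-(l : ℤ)) l,
      ∫ p, (f p : ℂ) * unsignedHarmonic l m p ∂angleMeasure = 0) : f =ᵐ[angleMeasure] 0 := by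
  have hfi : Integrable f angleMeasure := hf.integrable (by norm_num)
  have hfc : MemLp (fun p => (f p : ℂ)) 2 angleMeasure := hf.ofReal
  have hm₁ : AEMeasurable (fun p => ENNReal.ofReal (f p)) angleMeasure :=
    hf.aestronglyMeasurable.aemeasurable.ennreal_ofReal
  have hm₂ : AEMeasurable (fun p => ENNReal.ofReal (-f p)) angleMeasure :=
    hf.aestronglyMeasurable.aemeasurable.neg.ennreal_ofReal
  have hfin₁ : IsFiniteMeasure (angleMeasure.withDensity fun p => ENNReal.ofReal (f p)) :=
    isFiniteMeasure_withDensity_ofReal hfi.2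
  have hfin₂ : IsFiniteMeasure (angleMeasure.withDensity fun p => ENNReal.ofReal (-f p)) :=
    isFiniteMeasure_withDensity_ofReal hfi.neg.2
  -- The densities are `f⁺` and `f⁻`. Finite measures on the sphere that agree on a point-separating
  -- star algebra of continuous functions are equal, and the difference of the two integrals is the
  -- integral against `f`, which vanishes.
  have hmap : (angleMeasure.withDensity fun p => ENNReal.ofReal (f p)).map sphPoint
      = (angleMeasure.withDensity fun p => ENNReal.ofReal (-f p)).map sphPoint := by
    refine ext_of_forall_mem_subalgebra_integral_eq_of_polish separatesPoints_sphPolynomials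
      fun g hg => ?_
    have hgc : Continuous fun p => g (sphPoint p) := g.continuous.comp continuous_sphPoint
    have h0 := integral_mul_sphPolynomial_eq_zero hfc h hg
    rw [integral_map continuous_sphPoint.aemeasurable g.continuous.aestronglyMeasurable,
      integral_map continuous_sphPoint.aemeasurable g.continuous.aestronglyMeasurable,
      integral_withDensity_eq_integral_toReal_smul₀ hm₁ (by simp),
      integral_withDensity_eq_integral_toReal_smul₀ hm₂ (by simp), ← sub_eq_zero, ← integral_sub,
      ← h0]
    · refine integral_congr_ae (Filter.Eventually.of_forall fun p => ?_)
      simp only [ENNReal.toReal_ofReal', Complex.real_smul, ← sub_mul, ← Complex.ofReal_sub]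
      congr 2
      exact max_zero_sub_eq_self (f p)
    · have := integrable_mul_of_continuous (f := fun p => ((max (f p) 0 : ℝ) : ℂ))
        hf.pos_part.ofReal hgc
      simpa [ENNReal.toReal_ofReal', Complex.real_smul] using this
    · have := integrable_mul_of_continuous (f := fun p => ((max (-f p) 0 : ℝ) : ℂ))
        hf.neg.pos_part.ofReal hgc
      simpa [ENNReal.toReal_ofReal', Complex.real_smul] using this
  have heq := eq_of_map_sphPoint_eq (withDensity_absolutelyContinuous _ _)
    (withDensity_absolutelyContinuous _ _) hmap
  have hlt : ∫⁻ p, ENNReal.ofReal (f p) ∂angleMeasure ≠ ⊤ := by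
    have := measure_ne_top (angleMeasure.withDensity fun p => ENNReal.ofReal (f p)) univ
    rwa [withDensity_apply _ MeasurableSet.univ, setLIntegral_univ] at this
  filter_upwards [(withDensity_eq_iff hm₁ hm₂ hlt).mp heq] with p hp
  have := congrArg ENNReal.toReal hp
  rw [ENNReal.toReal_ofReal', ENNReal.toReal_ofReal'] at this
  rw [Pi.zero_apply, ← max_zero_sub_eq_self (f p), this, sub_self]

/-! ### Hilbert basis and Parseval's identity -/

/-- The indices of the spherical harmonics. -/
abbrev HarmonicIndex : Type := Σ l : ℕ, Finset.Icc (-(l : ℤ)) l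

/-- The spherical harmonics as elements of `L²`. -/
def harmonicLp (i : HarmonicIndex) : Lp ℂ 2 angleMeasure :=
  (memLp_angleMeasure_of_continuous (continuous_unsignedHarmonic i.1 i.2) 2).toLp

lemma coeFn_harmonicLp (i : HarmonicIndex) :
    harmonicLp i =ᵐ[angleMeasure] unsignedHarmonic i.1 i.2 := MemLp.coeFn_toLp _

lemma orthonormal_harmonicLp : Orthonormal ℂ harmonicLp := by
  classical
  rw [orthonormal_iff_ite]
  rintro ⟨l, m, hm⟩ ⟨l', m', hm'⟩
  rw [L2.inner_def]
  have h := integral_unsignedHarmonic_mul_conj (l := l') (l' := l) (m := m') (m' := m) hm'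
  have h2 : ∫ p, inner ℂ (harmonicLp ⟨l, m, hm⟩ p) (harmonicLp ⟨l', m', hm'⟩ p) ∂angleMeasure
      = ∫ p, (starRingEnd ℂ) (unsignedHarmonic l m p) * unsignedHarmonic l' m' p ∂angleMeasure := by
    refine integral_congr_ae ?_
    filter_upwards [coeFn_harmonicLp ⟨l, m, hm⟩, coeFn_harmonicLp ⟨l', m', hm'⟩] with p h1 h2
    rw [h1, h2, RCLike.inner_apply, mul_comm]
  rw [h2, h]
  have hiff : (l' = l ∧ m' = m) ↔ ((⟨l, m, hm⟩ : HarmonicIndex) = ⟨l', m', hm'⟩) := by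
    constructor
    · rintro ⟨rfl, rfl⟩; rfl
    · intro h
      obtain rfl : l = l' := congrArg Sigma.fst h
      simpa using h.symm
  simp only [hiff]

lemma conj_unsignedHarmonic (l : ℕ) (m : ℤ) (p : ℝ × ℝ) :
    (starRingEnd ℂ) (unsignedHarmonic l m p) = unsignedHarmonic l (-m) p := by
  simp only [unsignedHarmonic, map_mul, Complex.conj_ofReal, ← Complex.exp_conj, Int.natAbs_neg]
  simp

/-- Conjugation maps order `m` to `-m`, so the conjugate of an orthogonal function is orthogonal
too. Its real and imaginary parts then fall under the completeness for real functions. -/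
lemma span_harmonicLp_orthogonal : (Submodule.span ℂ (range harmonicLp))ᗮ = ⊥ := by
  rw [Submodule.eq_bot_iff]
  intro g hg
  have hgm : MemLp g 2 angleMeasure := Lp.memLp g
  have horth : ∀ l : ℕ, ∀ m ∈ Finset.Icc (-(l : ℤ)) l,
      ∫ p, (starRingEnd ℂ) (unsignedHarmonic l m p) * g p ∂angleMeasure = 0 := by
    intro l m hm
    have h1 := Submodule.inner_right_of_mem_orthogonal
      (Submodule.subset_span (mem_range_self (⟨l, m, hm⟩ : HarmonicIndex))) hg
    rw [L2.inner_def] at h1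
    rw [← h1]
    refine integral_congr_ae ?_
    filter_upwards [coeFn_harmonicLp ⟨l, m, hm⟩] with p h2
    rw [h2, RCLike.inner_apply, mul_comm]
  have hg₁ : ∀ l : ℕ, ∀ m ∈ Finset.Icc (-(l : ℤ)) l,
      ∫ p, g p * unsignedHarmonic l m p ∂angleMeasure = 0 := by
    intro l m hm
    rw [← horth l (-m) (by rw [Finset.mem_Icc] at hm ⊢; omega)]
    simp only [conj_unsignedHarmonic, neg_neg, mul_comm]
  have hg₂ : ∀ l : ℕ, ∀ m ∈ Finset.Icc (-(l : ℤ)) l,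
      ∫ p, (starRingEnd ℂ) (g p) * unsignedHarmonic l m p ∂angleMeasure = 0 := by
    intro l m hm
    have h1 := congrArg (starRingEnd ℂ) (horth l m hm)
    rw [← integral_conj, map_zero] at h1
    rw [← h1]
    simp [mul_comm]
  have hgc : MemLp (fun p => (starRingEnd ℂ) (g p)) 2 angleMeasure := hgm.star
  have hre := ae_eq_zero_of_integral_unsignedHarmonic_eq_zero (f := fun p => (g p).re) hgm.re
    fun l m hm => by
      have : ∀ p, (((g p).re : ℝ) : ℂ) * unsignedHarmonic l m p
          = 2⁻¹ * (g p * unsignedHarmonic l m p + (starRingEnd ℂ) (g p) * unsignedHarmonic l m p) := by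
        intro p
        rw [Complex.re_eq_add_conj]
        ring
      simp_rw [this]
      rw [integral_const_mul, integral_add
        (integrable_mul_of_continuous hgm (continuous_unsignedHarmonic _ _))
        (integrable_mul_of_continuous hgc (continuous_unsignedHarmonic _ _)), hg₁ l m hm, hg₂ l m hm]
      simp
  have him := ae_eq_zero_of_integral_unsignedHarmonic_eq_zero (f := fun p => (g p).im) hgm.im
    fun l m hm => by
      have : ∀ p, (((g p).im : ℝ) : ℂ) * unsignedHarmonic l m p
          = (2 * Complex.I)⁻¹ * (g p * unsignedHarmonic l m p
            - (starRingEnd ℂ) (g p) * unsignedHarmonic l m p) := by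
        intro p
        rw [Complex.im_eq_sub_conj]
        ring
      simp_rw [this]
      rw [integral_const_mul, integral_sub
        (integrable_mul_of_continuous hgm (continuous_unsignedHarmonic _ _))
        (integrable_mul_of_continuous hgc (continuous_unsignedHarmonic _ _)), hg₁ l m hm, hg₂ l m hm]
      simp
  refine (Lp.eq_zero_iff_ae_eq_zero).mpr ?_
  filter_upwards [hre, him] with p h1 h2
  exact Complex.ext h1 h2

/-- The spherical harmonics are a Hilbert basis of `L²`. -/
def harmonicBasis : HilbertBasis HarmonicIndex ℂ (Lp ℂ 2 angleMeasure) :=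
  HilbertBasis.mkOfOrthogonalEqBot orthonormal_harmonicLp span_harmonicLp_orthogonal

lemma hasSum_norm_inner_sq {ι E : Type*} [NormedAddCommGroup E] [InnerProductSpace ℂ E]
    (b : HilbertBasis ι ℂ E) (x : E) : HasSum (fun i => ‖inner ℂ (b i) x‖ ^ 2) (‖x‖ ^ 2) := by
  have h := b.hasSum_inner_mul_inner x x
  rw [inner_self_eq_norm_sq_to_K] at h
  have h2 : ∀ i, inner ℂ x (b i) * inner ℂ (b i) x = ((‖inner ℂ (b i) x‖ ^ 2 : ℝ) : ℂ) := by
    intro i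
    rw [← inner_conj_symm, Complex.conj_mul']
    push_cast
    rfl
  simp_rw [h2] at h
  rw [← Complex.hasSum_ofReal, Complex.ofReal_pow]
  exact h

lemma eLpNorm_two_sq {α E : Type*} [MeasurableSpace α] [NormedAddCommGroup E] (ν : Measure α)
    (f : α → E) : eLpNorm f 2 ν ^ 2 = ∫⁻ x, ‖f x‖ₑ ^ 2 ∂ν := by
  rw [eLpNorm_eq_lintegral_rpow_enorm_toReal two_ne_zero ENNReal.ofNat_ne_top,
    ← ENNReal.rpow_natCast, ← ENNReal.rpow_mul]
  simp

/-- Parseval's identity for the spherical harmonics. -/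
lemma lintegral_enorm_sq_eq_tsum {F : ℝ × ℝ → ℝ} (hF : MemLp F 2 angleMeasure) :
    ∫⁻ p, ‖F p‖ₑ ^ 2 ∂angleMeasure = ∑' l : ℕ, ∑ m ∈ Finset.Icc (-(l : ℤ)) l,
      ‖∫ p, (F p : ℂ) * (starRingEnd ℂ) (unsignedHarmonic l m p) ∂angleMeasure‖ₑ ^ 2 := by
  have hFc : MemLp (fun p => (F p : ℂ)) 2 angleMeasure := hF.ofReal
  have h := hasSum_norm_inner_sq harmonicBasis hFc.toLp
  have hin : ∀ i, inner ℂ (harmonicBasis i) hFc.toLp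
      = ∫ p, (F p : ℂ) * (starRingEnd ℂ) (unsignedHarmonic i.1 i.2 p) ∂angleMeasure := by
    intro i
    rw [harmonicBasis, HilbertBasis.coe_mkOfOrthogonalEqBot, L2.inner_def]
    refine integral_congr_ae ?_
    filter_upwards [coeFn_harmonicLp i, hFc.coeFn_toLp] with p h1 h2
    rw [h1, h2, RCLike.inner_apply]
  have hnorm : ENNReal.ofReal (‖hFc.toLp‖ ^ 2) = ∫⁻ p, ‖F p‖ₑ ^ 2 ∂angleMeasure := by
    rw [Lp.norm_toLp, ENNReal.ofReal_pow ENNReal.toReal_nonneg,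
      ENNReal.ofReal_toReal hFc.eLpNorm_ne_top, eLpNorm_two_sq]
    simp [enorm_eq_nnnorm]
  rw [← hnorm, ← h.tsum_eq, ENNReal.ofReal_tsum_of_nonneg (fun _ => by positivity) h.summable,
    ENNReal.tsum_sigma']
  refine tsum_congr fun l => ?_
  rw [tsum_fintype, ← Finset.sum_coe_sort (Finset.Icc (-(l : ℤ)) l)]
  refine Finset.sum_congr rfl fun m _ => ?_
  rw [hin, ENNReal.ofReal_pow (norm_nonneg _), ofReal_norm]

/-! ### The damped oscillator -/

/-- The energy estimate for the damped oscillator `d g' + α g'' + β g = 0`, `g'(0) = 0`. -/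
lemma abs_sub_le_of_damped_oscillator {b α β : ℝ} (hα : 0 < α) (hβ : 0 ≤ β)
    {d g g₁ g₂ : ℝ → ℝ} (hd : ∀ t ∈ Ico 0 b, 0 ≤ d t)
    (hg : ∀ t ∈ Ico 0 b, HasDerivWithinAt g (g₁ t) (Ico 0 b) t)
    (hg₁ : ∀ t ∈ Ico 0 b, HasDerivWithinAt g₁ (g₂ t) (Ico 0 b) t)
    (heq : ∀ t ∈ Ico 0 b, d t * g₁ t + α * g₂ t + β * g t = 0) (h0 : g₁ 0 = 0)
    {x y : ℝ} (hx : x ∈ Ico 0 b) (hy : y ∈ Ico 0 b) :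
    |g y - g x| ≤ Real.sqrt (β / α) * |g 0| * |y - x| := by
  -- By the equation, the energy has derivative `2 g' (α g'' + β g) = -2 d g'²`.
  have hderiv : ∀ t ∈ Ico 0 b, HasDerivWithinAt (fun t => α * g₁ t ^ 2 + β * g t ^ 2)
      (-(2 * d t * g₁ t ^ 2)) (Ico 0 b) t := by
    intro t ht
    refine ((((hg₁ t ht).pow 2).const_mul α).add (((hg t ht).pow 2).const_mul β)).congr_deriv ?_
    simp only [Nat.cast_ofNat, Nat.add_one_sub_one, pow_one]
    linear_combination 2 * g₁ t * heq t ht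
  have hanti : AntitoneOn (fun t => α * g₁ t ^ 2 + β * g t ^ 2) (Ico 0 b) := by
    refine antitoneOn_of_deriv_nonpos (convex_Ico 0 b) (fun t ht => (hderiv t ht).continuousWithinAt)
      (fun t ht => ?_) fun t ht => ?_
    · exact ((hderiv t (interior_subset ht)).mono interior_subset).differentiableWithinAt
    · have h1 := (hderiv t (interior_subset ht)).hasDerivAt (mem_interior_iff_mem_nhds.mp ht)
      rw [h1.deriv]
      have := mul_nonneg (hd t (interior_subset ht)) (sq_nonneg (g₁ t))
      linarith
  -- Since `g'(0) = 0`, the initial energy is `β g(0)²`.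
  have hbound : ∀ t ∈ Ico 0 b, ‖g₁ t‖ ≤ Real.sqrt (β / α) * |g 0| := by
    intro t ht
    have h1 := hanti ⟨le_rfl, ht.1.trans_lt ht.2⟩ ht ht.1
    simp only [h0] at h1
    have h2 := mul_nonneg hβ (sq_nonneg (g t))
    refine abs_le_of_sq_le_sq ?_ (by positivity)
    rw [mul_pow, Real.sq_sqrt (by positivity), sq_abs, div_mul_eq_mul_div, le_div_iff₀ hα]
    linarith
  exact (convex_Ico 0 b).norm_image_sub_le_of_norm_hasDerivWithin_le hg hbound hx hy

/-! ### Real harmonics as eigenfunctions of the Laplace–Beltrami operator -/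

/-- The angular part of a real spherical harmonic. -/
def angularPart (b : Bool) (m : ℤ) (s : ℝ) : ℝ := if b then Real.cos (m * s) else Real.sin (m * s)

/-- The real (`b = true`) or imaginary part of `unsignedHarmonic`. -/
def realHarmonic (l : ℕ) (m : ℤ) (b : Bool) (p : ℝ × ℝ) : ℝ :=
  sphAmp l m.natAbs * (Real.sin p.1 ^ m.natAbs * (legendreDeriv l m.natAbs).eval (Real.cos p.1))
    * angularPart b m p.2

lemma unsignedHarmonic_eq (l : ℕ) (m : ℤ) (p : ℝ × ℝ) :
    unsignedHarmonic l m p = realHarmonic l m true p + Complex.I * realHarmonic l m false p := by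
  have h : Complex.exp (Complex.I * m * p.2)
      = (Real.cos (m * p.2) : ℂ) + Complex.I * (Real.sin (m * p.2) : ℂ) := by
    rw [mul_assoc, mul_comm Complex.I, Complex.exp_mul_I]
    push_cast
    ring
  simp only [unsignedHarmonic, h, realHarmonic, angularPart, if_true]
  push_cast
  ring

lemma continuous_realHarmonic (l : ℕ) (m : ℤ) (b : Bool) : Continuous (realHarmonic l m b) := by
  unfold realHarmonic angularPart
  cases b <;> simp <;> fun_prop

/-- A polynomial on `ℝ³` that extends the real harmonic `realHarmonic l m b`. -/
def harmonicExt (l : ℕ) (m : ℤ) (b : Bool) (x : E3) : ℝ :=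
  sphAmp l m.natAbs * (legendreDeriv l m.natAbs).eval (x 0) *
    (if b then (((x 1 : ℝ) + (m.sign : ℂ) * Complex.I * (x 2 : ℝ)) ^ m.natAbs).re
      else (((x 1 : ℝ) + (m.sign : ℂ) * Complex.I * (x 2 : ℝ)) ^ m.natAbs).im)

lemma contDiff_harmonicExt (l : ℕ) (m : ℤ) (b : Bool) :
    ContDiff ℝ (⊤ : ℕ∞) (harmonicExt l m b) := by
  have hcoord : ∀ i : Fin 3, ContDiff ℝ (⊤ : ℕ∞) fun x : E3 => x i := by
    intro i; fun_prop
  have hP : ContDiff ℝ (⊤ : ℕ∞) fun x : E3 => (legendreDeriv l m.natAbs).eval (x 0) :=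
    (by simpa using (legendreDeriv l m.natAbs).contDiff_aeval (𝕜 := ℝ) (⊤ : ℕ∞) :
      ContDiff ℝ (⊤ : ℕ∞) fun x : ℝ => (legendreDeriv l m.natAbs).eval x).comp (hcoord 0)
  have hz : ContDiff ℝ (⊤ : ℕ∞) fun x : E3 =>
      (((x 1 : ℝ) + (m.sign : ℂ) * Complex.I * (x 2 : ℝ)) ^ m.natAbs : ℂ) :=
    ((Complex.ofRealCLM.contDiff.comp (hcoord 1)).add
      (contDiff_const.mul (Complex.ofRealCLM.contDiff.comp (hcoord 2)))).pow _
  unfold harmonicExt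
  cases b
  · exact (contDiff_const.mul hP).mul (Complex.imCLM.contDiff.comp hz)
  · exact (contDiff_const.mul hP).mul (Complex.reCLM.contDiff.comp hz)

/-- De Moivre's formula, with `m.sign` choosing between `x₁ + i x₂` and its conjugate. At `m = 0`
the sign is `0`, but so is the exponent. -/
lemma harmonicExt_sphPoint (l : ℕ) (m : ℤ) (b : Bool) (p : ℝ × ℝ) :
    harmonicExt l m b (sphPoint p) = realHarmonic l m b p := by
  have hz : ((((Real.sin p.1 * Real.cos p.2 : ℝ) : ℂ)
      + (m.sign : ℂ) * Complex.I * ((Real.sin p.1 * Real.sin p.2 : ℝ) : ℂ)) ^ m.natAbs)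
      = ((Real.sin p.1 ^ m.natAbs : ℝ) : ℂ) *
        ((Real.cos (m * p.2) : ℂ) + (Real.sin (m * p.2) : ℂ) * Complex.I) := by
    have h1 : ((Real.sin p.1 * Real.cos p.2 : ℝ) : ℂ)
        + (m.sign : ℂ) * Complex.I * ((Real.sin p.1 * Real.sin p.2 : ℝ) : ℂ)
        = (Real.sin p.1 : ℂ) * (Complex.cos p.2 + (m.sign : ℂ) * Complex.sin p.2 * Complex.I) := by
      push_cast
      ring
    rw [h1, mul_pow]
    push_cast
    congr 1
    rcases lt_trichotomy m 0 with h | h | h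
    · obtain ⟨k, rfl⟩ : ∃ k : ℕ, m = -(k : ℤ) := ⟨m.natAbs, by omega⟩
      rw [Int.sign_eq_neg_one_of_neg h]
      have := Complex.cos_add_sin_mul_I_pow k (-(p.2 : ℂ))
      simp at this ⊢
      exact this
    · subst h
      simp
    · obtain ⟨k, rfl⟩ : ∃ k : ℕ, m = (k : ℤ) := ⟨m.natAbs, by omega⟩
      rw [Int.sign_eq_one_of_pos h]
      have := Complex.cos_add_sin_mul_I_pow k (p.2 : ℂ)
      simp at this ⊢
      exact this
  have hx0 : (sphPoint p : E3) 0 = Real.cos p.1 := rfl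
  have hx1 : (sphPoint p : E3) 1 = Real.sin p.1 * Real.cos p.2 := rfl
  have hx2 : (sphPoint p : E3) 2 = Real.sin p.1 * Real.sin p.2 := rfl
  unfold harmonicExt realHarmonic angularPart
  rw [hx0, hx1, hx2, hz, Complex.re_ofReal_mul, Complex.im_ofReal_mul]
  cases b <;> simp [-Complex.ofReal_cos, -Complex.ofReal_sin] <;> ring

lemma iteratedDeriv_two_angularPart (b : Bool) (m : ℤ) (a s : ℝ) :
    iteratedDeriv 2 (fun s => a * angularPart b m s) s = -(m : ℝ) ^ 2 * (a * angularPart b m s) := by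
  have hlin : ∀ s : ℝ, HasDerivAt (fun s : ℝ => (m : ℝ) * s) m s := fun s => by
    simpa using (hasDerivAt_id s).const_mul (m : ℝ)
  have hc : ∀ s : ℝ, HasDerivAt (fun s : ℝ => Real.cos (m * s)) (-Real.sin (m * s) * m) s :=
    fun s => (hlin s).cos
  have hs : ∀ s : ℝ, HasDerivAt (fun s : ℝ => Real.sin (m * s)) (Real.cos (m * s) * m) s :=
    fun s => (hlin s).sin
  rw [iteratedDeriv_succ, iteratedDeriv_one]
  cases b
  · simp only [angularPart, Bool.false_eq_true, if_false]
    rw [show deriv (fun s => a * Real.sin (m * s)) = fun s => a * (Real.cos (m * s) * m) from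
      funext fun s => ((hs s).const_mul a).deriv, (((hc s).mul_const (m : ℝ)).const_mul a).deriv]
    ring
  · simp only [angularPart, if_true]
    rw [show deriv (fun s => a * Real.cos (m * s)) = fun s => a * (-Real.sin (m * s) * m) from
      funext fun s => ((hc s).const_mul a).deriv]
    exact (((hs s).neg.mul_const (m : ℝ)).const_mul a).deriv.trans (by ring)

lemma hasDerivAt_eval_cos_mul_sin_pow (P : Polynomial ℝ) (k : ℕ) (t : ℝ) :
    HasDerivAt (fun t => P.eval (Real.cos t) * Real.sin t ^ k)
      (-((Polynomial.derivative P).eval (Real.cos t) * Real.sin t ^ (k + 1))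
        + k * (P.eval (Real.cos t) * (Real.sin t ^ (k - 1) * Real.cos t))) t := by
  have h1 := ((P.hasDerivAt (Real.cos t)).comp t (Real.hasDerivAt_cos t)).mul
    ((Real.hasDerivAt_sin t).pow k)
  refine h1.congr_deriv ?_
  simp only [Function.comp, Pi.pow_apply]
  ring

/-- The substitution `x = cos t` turns the Gegenbauer equation into the polar part of the Laplacian.
-/
lemma polar_laplacian_eq (P : Polynomial ℝ) (k : ℕ) (lam : ℝ) (hP : GegenbauerODE k lam P) {t : ℝ}
    (ht : t ∈ Ioo 0 Real.pi) :
    iteratedDeriv 2 (fun t => P.eval (Real.cos t) * Real.sin t ^ k) t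
      + Real.cot t * deriv (fun t => P.eval (Real.cos t) * Real.sin t ^ k) t
      + 1 / Real.sin t ^ 2 * (-(k : ℝ) ^ 2 * (P.eval (Real.cos t) * Real.sin t ^ k))
      = -lam * (P.eval (Real.cos t) * Real.sin t ^ k) := by
  have hsin := (Real.sin_pos_of_mem_Ioo ht).ne'
  have hode := congrArg (Polynomial.eval (Real.cos t)) hP
  simp at hode
  have hd : deriv (fun t => P.eval (Real.cos t) * Real.sin t ^ k) = fun t =>
      (-((Polynomial.derivative P).eval (Real.cos t) * Real.sin t ^ (k + 1))
        + k * (P.eval (Real.cos t) * (Real.sin t ^ (k - 1) * Real.cos t))) :=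
    funext fun t => (hasDerivAt_eval_cos_mul_sin_pow P k t).deriv
  have hcos : HasDerivAt (fun t => P.eval (Real.cos t) * (Real.sin t ^ (k - 1) * Real.cos t)) _ t :=
    ((hasDerivAt_eval_cos_mul_sin_pow P (k - 1) t).mul (Real.hasDerivAt_cos t)).congr_of_eventuallyEq
      (Filter.Eventually.of_forall fun t => by simp only [Pi.mul_apply]; ring)
  have hd2 := ((hasDerivAt_eval_cos_mul_sin_pow (Polynomial.derivative P) (k + 1) t).neg.add
    (hcos.const_mul (k : ℝ))).deriv
  rw [iteratedDeriv_succ, iteratedDeriv_one, hd]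
  erw [hd2]
  rw [Real.cot_eq_cos_div_sin]
  have hsq := Real.sin_sq t
  simp only [Nat.add_sub_cancel]
  -- The exponents `k - 1` and `k - 1 - 1` are truncated for `k = 0, 1`, so these cases are
  -- separate.
  rcases k with _ | _ | k
  · simp at hode ⊢
    field_simp
    linear_combination -hode + (Polynomial.derivative (Polynomial.derivative P)).eval (Real.cos t) * hsq
  · simp at hode ⊢
    field_simp
    linear_combination -Real.sin t ^ 2 * hode
      + (Real.sin t ^ 2 * (Polynomial.derivative (Polynomial.derivative P)).eval (Real.cos t) + P.eval (Real.cos t)) * hsq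
  · simp at hode ⊢
    field_simp
    linear_combination -Real.sin t ^ (k + 4) * hode
      + (Real.sin t ^ (k + 4) * (Polynomial.derivative (Polynomial.derivative P)).eval (Real.cos t)
        + (k + 2) ^ 2 * Real.sin t ^ (k + 2) * P.eval (Real.cos t)) * hsq

lemma sphLaplacian_harmonicExt (l : ℕ) (m : ℤ) (b : Bool) {p : ℝ × ℝ} (hp : p.1 ∈ Ioo 0 Real.pi) :
    sphLaplacian (harmonicExt l m b) p = -((l : ℝ) * (l + 1)) * realHarmonic l m b p := by
  set k := m.natAbs
  set P := legendreDeriv l k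
  have h := polar_laplacian_eq P k _ (gegenbauerODE_legendre l k) hp
  have hmk : (m : ℝ) ^ 2 = (k : ℝ) ^ 2 := by
    have : m ^ 2 = (k : ℤ) ^ 2 := by simp [k]
    exact_mod_cast this
  have h1 : (fun t => harmonicExt l m b (sphPoint (t, p.2)))
      = fun t => (sphAmp l k * angularPart b m p.2) * (P.eval (Real.cos t) * Real.sin t ^ k) := by
    funext t
    rw [harmonicExt_sphPoint, realHarmonic]
    ring
  have h2 : (fun s => harmonicExt l m b (sphPoint (p.1, s)))
      = fun s => (sphAmp l k * (Real.sin p.1 ^ k * P.eval (Real.cos p.1))) * angularPart b m s := by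
    funext s
    rw [harmonicExt_sphPoint, realHarmonic]
  have h3 : realHarmonic l m b p
      = sphAmp l k * (Real.sin p.1 ^ k * P.eval (Real.cos p.1)) * angularPart b m p.2 := rfl
  unfold sphLaplacian
  rw [h1, h2, iteratedDeriv_two_angularPart, iteratedDeriv_const_mul_field, deriv_const_mul_field,
    hmk, h3]
  linear_combination (sphAmp l k * angularPart b m p.2) * h

/-! ### Coefficients of random fields -/

lemma enorm_sq_eq_ofReal_sq {E : Type*} [NormedAddCommGroup E] (x : E) :
    ‖x‖ₑ ^ 2 = ENNReal.ofReal (‖x‖ ^ 2) := by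
  rw [ENNReal.ofReal_pow (norm_nonneg _), ofReal_norm]

section Coefficients

variable {Ω : Type*} [MeasurableSpace Ω] {μ : Measure Ω} [IsProbabilityMeasure μ]

/-- The coefficient of a random field with respect to a real spherical harmonic. -/
def realCoeff (V : (ℝ × ℝ) × Ω → ℝ) (l : ℕ) (m : ℤ) (b : Bool) (ω : Ω) : ℝ :=
  ∫ p, V (p, ω) * realHarmonic l m b p ∂angleMeasure

lemma integral_conj_unsignedHarmonic {F : ℝ × ℝ → ℝ} (hF : MemLp F 2 angleMeasure) (l : ℕ) (m : ℤ) :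
    ∫ p, (F p : ℂ) * (starRingEnd ℂ) (unsignedHarmonic l m p) ∂angleMeasure
      = ((∫ p, F p * realHarmonic l m true p ∂angleMeasure : ℝ) : ℂ)
        - Complex.I * ((∫ p, F p * realHarmonic l m false p ∂angleMeasure : ℝ) : ℂ) := by
  have hint : ∀ b, Integrable (fun p => F p * realHarmonic l m b p) angleMeasure := fun b =>
    hF.integrable_mul (memLp_angleMeasure_of_continuous (continuous_realHarmonic l m b) 2)
  rw [← integral_complex_ofReal, ← integral_complex_ofReal, ← integral_const_mul, ← integral_sub]
  · refine integral_congr_ae (Filter.Eventually.of_forall fun p => ?_)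
    simp only [unsignedHarmonic_eq, map_add, map_mul, Complex.conj_ofReal, Complex.conj_I]
    push_cast
    ring
  · exact (hint true).ofReal
  · exact (hint false).ofReal.const_mul _

lemma norm_sq_integral_conj_unsignedHarmonic {F : ℝ × ℝ → ℝ} (hF : MemLp F 2 angleMeasure) (l : ℕ)
    (m : ℤ) : ‖∫ p, (F p : ℂ) * (starRingEnd ℂ) (unsignedHarmonic l m p) ∂angleMeasure‖ ^ 2
      = ∑ b, (∫ p, F p * realHarmonic l m b p ∂angleMeasure) ^ 2 := by
  rw [integral_conj_unsignedHarmonic hF, ← Complex.normSq_eq_norm_sq, Complex.normSq_apply]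
  simp
  ring

/-- The real family is redundant, as orders `m` and `-m` agree up to sign. The identity still holds
exactly, because for real `F` the two real coefficients are, up to sign, the real and imaginary
parts of the complex one. -/
lemma lintegral_enorm_sq_eq_tsum_real {F : ℝ × ℝ → ℝ} (hF : MemLp F 2 angleMeasure) :
    ∫⁻ p, ‖F p‖ₑ ^ 2 ∂angleMeasure = ∑' l : ℕ, ∑ m ∈ Finset.Icc (-(l : ℤ)) l, ∑ b,
      ‖∫ p, F p * realHarmonic l m b p ∂angleMeasure‖ₑ ^ 2 := by
  rw [lintegral_enorm_sq_eq_tsum hF]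
  refine tsum_congr fun l => Finset.sum_congr rfl fun m _ => ?_
  rw [enorm_sq_eq_ofReal_sq, norm_sq_integral_conj_unsignedHarmonic hF,
    ENNReal.ofReal_sum_of_nonneg fun _ _ => sq_nonneg _]
  simp only [enorm_sq_eq_ofReal_sq, Real.norm_eq_abs, sq_abs]

lemma enorm_sq_integral_realHarmonic_le {F : ℝ × ℝ → ℝ} (hF : MemLp F 2 angleMeasure) {l : ℕ}
    {m : ℤ} (hm : m ∈ Finset.Icc (-(l : ℤ)) l) (b : Bool) :
    ‖∫ p, F p * realHarmonic l m b p ∂angleMeasure‖ₑ ^ 2 ≤ ∫⁻ p, ‖F p‖ₑ ^ 2 ∂angleMeasure := by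
  rw [lintegral_enorm_sq_eq_tsum_real hF]
  refine le_trans ?_ (ENNReal.le_tsum l)
  refine le_trans ?_ (Finset.single_le_sum (fun _ _ => zero_le) hm)
  exact Finset.single_le_sum (f := fun b => ‖∫ p, F p * realHarmonic l m b p ∂angleMeasure‖ₑ ^ 2)
    (fun _ _ => zero_le) (Finset.mem_univ b)

variable {V : (ℝ × ℝ) × Ω → ℝ}

lemma lintegral_enorm_sq_prod (hV : MemLp V 2 (angleMeasure.prod μ)) :
    ∫⁻ q, ‖V q‖ₑ ^ 2 ∂(angleMeasure.prod μ)
      = ∫⁻ ω, ∫⁻ p, ‖V (p, ω)‖ₑ ^ 2 ∂angleMeasure ∂μ :=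
  lintegral_prod_symm _ (hV.aestronglyMeasurable.enorm.pow_const 2)

lemma ae_memLp_section (hV : MemLp V 2 (angleMeasure.prod μ)) :
    ∀ᵐ ω ∂μ, MemLp (fun p => V (p, ω)) 2 angleMeasure := by
  have h1 := hV.aestronglyMeasurable.prod_swap.prodMk_left
  have hfin : ∫⁻ ω, ∫⁻ p, ‖V (p, ω)‖ₑ ^ 2 ∂angleMeasure ∂μ ≠ ⊤ := by
    rw [← lintegral_enorm_sq_prod hV, ← eLpNorm_two_sq]
    exact ENNReal.pow_ne_top hV.eLpNorm_ne_top
  have h2 := ae_lt_top' (hV.aestronglyMeasurable.enorm.pow_const 2).prod_swap.lintegral_prod_right' hfin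
  filter_upwards [h1, h2] with ω h3 h4
  refine ⟨h3, ?_⟩
  have h5 : eLpNorm (fun p => V (p, ω)) 2 angleMeasure ^ 2 < ⊤ := by
    rw [eLpNorm_two_sq]; exact h4
  exact (ENNReal.pow_lt_top_iff.mp h5).resolve_right two_ne_zero

/-- Bessel's inequality for almost every `ω`, integrated over `Ω`. It makes the coefficient
admissible as a test variable `χ`. -/
lemma memLp_realCoeff (hV : MemLp V 2 (angleMeasure.prod μ)) {l : ℕ} {m : ℤ}
    (hm : m ∈ Finset.Icc (-(l : ℤ)) l) (b : Bool) : MemLp (realCoeff V l m b) 2 μ := by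
  have hmeas : AEStronglyMeasurable (realCoeff V l m b) μ := by
    have h1 : AEStronglyMeasurable (fun q : (ℝ × ℝ) × Ω => V q * realHarmonic l m b q.1)
        (angleMeasure.prod μ) := hV.aestronglyMeasurable.mul
      ((continuous_realHarmonic l m b).comp_aestronglyMeasurable measurable_fst.aestronglyMeasurable)
    exact h1.prod_swap.integral_prod_right'
  refine ⟨hmeas, ?_⟩
  have h5 : eLpNorm (realCoeff V l m b) 2 μ ^ 2 < ⊤ := by
    rw [eLpNorm_two_sq]
    refine lt_of_le_of_lt (lintegral_mono_ae (g := fun ω => ∫⁻ p, ‖V (p, ω)‖ₑ ^ 2 ∂angleMeasure) ?_) ?_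
    · filter_upwards [ae_memLp_section hV] with ω hω
      exact enorm_sq_integral_realHarmonic_le hω hm b
    · rw [← lintegral_enorm_sq_prod hV, ← eLpNorm_two_sq]
      exact ENNReal.pow_lt_top hV.eLpNorm_lt_top
  exact (ENNReal.pow_lt_top_iff.mp h5).resolve_right two_ne_zero

lemma memLp_realHarmonic_mul {χ : Ω → ℝ} (hχ : MemLp χ 2 μ) (l : ℕ) (m : ℤ) (b : Bool) :
    MemLp (fun q : (ℝ × ℝ) × Ω => realHarmonic l m b q.1 * χ q.2) 2 (angleMeasure.prod μ) :=
  MemLp.mul' (p := ⊤) (q := 2) (hχ.comp_snd angleMeasure)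
    ((memLp_angleMeasure_of_continuous (continuous_realHarmonic l m b) ⊤).comp_fst μ)

/-- Fubini, translating the weak pairing with `ψ ⊗ χ` into an expectation of the coefficient times
`χ`. -/
lemma integral_mul_realHarmonic_mul (hV : MemLp V 2 (angleMeasure.prod μ)) {χ : Ω → ℝ}
    (hχ : MemLp χ 2 μ) (l : ℕ) (m : ℤ) (b : Bool) :
    ∫ q, V q * (realHarmonic l m b q.1 * χ q.2) ∂(angleMeasure.prod μ)
      = ∫ ω, realCoeff V l m b ω * χ ω ∂μ := by
  have hint : Integrable (fun q : (ℝ × ℝ) × Ω => V q * (realHarmonic l m b q.1 * χ q.2))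
      (angleMeasure.prod μ) := hV.integrable_mul (memLp_realHarmonic_mul hχ l m b)
  rw [integral_prod_symm _ hint]
  refine integral_congr_ae (Filter.Eventually.of_forall fun ω => ?_)
  simp only [realCoeff, ← mul_assoc, integral_mul_const]

/-- Parseval's identity for random fields. -/
lemma lintegral_enorm_sq_prod_eq_tsum (hV : MemLp V 2 (angleMeasure.prod μ)) :
    ∫⁻ q, ‖V q‖ₑ ^ 2 ∂(angleMeasure.prod μ) = ∑' l : ℕ, ENNReal.ofReal
      (∑ m ∈ Finset.Icc (-(l : ℤ)) l, ∑ b, ∫ ω, realCoeff V l m b ω ^ 2 ∂μ) := by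
  have hmeas : ∀ l : ℕ, ∀ m ∈ Finset.Icc (-(l : ℤ)) l, ∀ b,
      AEMeasurable (fun ω => ‖realCoeff V l m b ω‖ₑ ^ 2) μ := fun l m hm b =>
    (memLp_realCoeff hV hm b).aestronglyMeasurable.enorm.pow_const 2
  have h1 : ∫⁻ ω, ∫⁻ p, ‖V (p, ω)‖ₑ ^ 2 ∂angleMeasure ∂μ
      = ∫⁻ ω, ∑' l : ℕ, ∑ m ∈ Finset.Icc (-(l : ℤ)) l, ∑ b, ‖realCoeff V l m b ω‖ₑ ^ 2 ∂μ := by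
    refine lintegral_congr_ae ?_
    filter_upwards [ae_memLp_section hV] with ω hω
    exact lintegral_enorm_sq_eq_tsum_real hω
  rw [lintegral_enorm_sq_prod hV, h1, lintegral_tsum fun l => Finset.aemeasurable_fun_sum _ fun m hm =>
    Finset.aemeasurable_fun_sum _ fun b _ => hmeas l m hm b]
  refine tsum_congr fun l => ?_
  rw [lintegral_finsetSum' _ fun m hm => Finset.aemeasurable_fun_sum _ fun b _ => hmeas l m hm b,
    ENNReal.ofReal_sum_of_nonneg fun m _ => Finset.sum_nonneg fun b _ =>
      integral_nonneg fun ω => sq_nonneg _]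
  refine Finset.sum_congr rfl fun m hm => ?_
  rw [lintegral_finsetSum' _ fun b _ => hmeas l m hm b,
    ENNReal.ofReal_sum_of_nonneg fun b _ => integral_nonneg fun ω => sq_nonneg _]
  refine Finset.sum_congr rfl fun b _ => ?_
  rw [ofReal_integral_eq_lintegral_ofReal (memLp_realCoeff hV hm b).integrable_sq
    (Filter.Eventually.of_forall fun ω => sq_nonneg _)]
  simp only [enorm_sq_eq_ofReal_sq, Real.norm_eq_abs, sq_abs]

end Coefficients

/-! ### Power spectrum and coefficients of a solution -/

section Field

variable {Ω : Type*} [MeasurableSpace Ω] {μ : Measure Ω}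

lemma angularPowerSpectrum_nonneg (T : Sphere2 → Ω → ℝ) (l : ℕ) : 0 ≤ angularPowerSpectrum μ T l :=
  div_nonneg (Finset.sum_nonneg fun _ _ => integral_nonneg fun _ => sq_nonneg _) (by positivity)

/-- A random field in spherical coordinates. -/
def coordField (T : Sphere2 → Ω → ℝ) (q : (ℝ × ℝ) × Ω) : ℝ := T (sphPoint q.1) q.2

lemma integral_mul_sphLaplacian_harmonicExt (v : Sphere2 → Ω → ℝ) (χ : Ω → ℝ) (l : ℕ) (m : ℤ)
    (b : Bool) :
    ∫ q, v (sphPoint q.1) q.2 * (sphLaplacian (harmonicExt l m b) q.1 * χ q.2)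
      ∂(angleMeasure.prod μ) = -((l : ℝ) * (l + 1)) *
        ∫ q, coordField v q * (realHarmonic l m b q.1 * χ q.2) ∂(angleMeasure.prod μ) := by
  rw [← integral_const_mul]
  refine integral_congr_ae ?_
  filter_upwards [Measure.quasiMeasurePreserving_fst.ae ae_angleMeasure_mem_Ioo] with q hq
  rw [sphLaplacian_harmonicExt l m b hq.1, coordField]
  ring

variable [IsProbabilityMeasure μ]

lemma integral_norm_laplaceCoeff_sq {T : Sphere2 → Ω → ℝ} (hT : IsSquareIntegrableField μ T) {l : ℕ}
    {m : ℤ} (hm : m ∈ Finset.Icc (-(l : ℤ)) l) :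
    ∫ ω, ‖laplaceCoeff T l m ω‖ ^ 2 ∂μ
      = ∑ b, ∫ ω, realCoeff (coordField T) l m b ω ^ 2 ∂μ := by
  have hV : MemLp (coordField T) 2 (angleMeasure.prod μ) := hT
  rw [← integral_finsetSum _ fun b _ => (memLp_realCoeff hV hm b).integrable_sq]
  refine integral_congr_ae ?_
  filter_upwards [ae_memLp_section hV] with ω hω
  have h1 : laplaceCoeff T l m ω = (harmonicSign m : ℂ) *
      ∫ p, (coordField T (p, ω) : ℂ) * (starRingEnd ℂ) (unsignedHarmonic l m p) ∂angleMeasure := by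
    rw [laplaceCoeff, ← integral_const_mul]
    refine integral_congr_ae ?_
    filter_upwards [ae_angleMeasure_mem_rectangle] with p hp
    rw [sphHarmonic_eq hm hp.1, map_mul, Complex.conj_ofReal]
    simp only [coordField]
    ring
  have h2 : ‖(harmonicSign m : ℂ)‖ ^ 2 = 1 := by
    rw [Complex.norm_real, Real.norm_eq_abs, sq_abs, sq, harmonicSign_mul_self]
  rw [h1, norm_mul, mul_pow, h2, one_mul, norm_sq_integral_conj_unsignedHarmonic hω]
  rfl

lemma sum_realCoeff_sq_eq {T : Sphere2 → Ω → ℝ} (hT : IsSquareIntegrableField μ T) (l : ℕ) :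
    ∑ m ∈ Finset.Icc (-(l : ℤ)) l, ∑ b, ∫ ω, realCoeff (coordField T) l m b ω ^ 2 ∂μ
      = (2 * l + 1) * angularPowerSpectrum μ T l := by
  have h : (2 * (l : ℝ) + 1) ≠ 0 := by positivity
  rw [angularPowerSpectrum, mul_div_cancel₀ _ h]
  exact Finset.sum_congr rfl fun m hm => (integral_norm_laplaceCoeff_sq hT hm).symm

lemma dampingCoeff_nonneg {c D ηinf η : ℝ} (hD : 0 < D) (hη : η ∈ Ico 0 ηinf) :
    0 ≤ dampingCoeff c D ηinf η := by
  have h1 : 0 < ηinf - η := sub_pos.mpr hη.2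
  have h2 : 0 ≤ ηinf := hη.1.trans hη.2.le
  have hd : HasDerivAt (expansionFactor ηinf) (ηinf / (ηinf - η) ^ 2) η := by
    refine ((hasDerivAt_const η ηinf).div ((hasDerivAt_id η).const_sub ηinf) h1.ne').congr_deriv ?_
    simp
  unfold dampingCoeff
  rw [hd.deriv]
  unfold expansionFactor
  positivity

variable {c D r ηinf : ℝ} {T : Sphere2 → Ω → ℝ} {u : ℝ → Sphere2 → Ω → ℝ}

/-- The time increments of the coefficients of a solution. -/
lemma integral_realCoeff_increment_sq_le (hc : 0 < c) (hD : 0 < D)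
    (hu : IsSolution c D r ηinf μ T u) (hT : IsSquareIntegrableField μ T)
    {l : ℕ} {m : ℤ} (hm : m ∈ Finset.Icc (-(l : ℤ)) l) (b : Bool) {x y : ℝ} (hx : x ∈ Ico 0 ηinf)
    (hy : y ∈ Ico 0 ηinf) :
    ∫ ω, realCoeff (coordField fun p ω => u y p ω - u x p ω) l m b ω ^ 2 ∂μ
      ≤ c ^ 2 / r ^ 2 * (l * (l + 1)) * (y - x) ^ 2 *
        ∫ ω, realCoeff (coordField T) l m b ω ^ 2 ∂μ := by
  have hV : ∀ t ∈ Ico 0 ηinf, MemLp (coordField (u t)) 2 (angleMeasure.prod μ) := hu.memL2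
  have hTV : MemLp (coordField T) 2 (angleMeasure.prod μ) := hT
  have hΔ : MemLp (coordField fun p ω => u y p ω - u x p ω) 2 (angleMeasure.prod μ) :=
    (hV y hy).sub (hV x hx)
  -- The test variable is the increment itself, with `x` and `y` held fixed, so that `g y - g x`
  -- becomes `E χ²`.
  set χ := realCoeff (coordField fun p ω => u y p ω - u x p ω) l m b with hχdef
  set τ := realCoeff (coordField T) l m b
  have hχ : MemLp χ 2 μ := memLp_realCoeff hΔ hm b
  have hτ : MemLp τ 2 μ := memLp_realCoeff hTV hm b
  obtain ⟨g₁, g₂, hg, hg₁, heq, h0⟩ := hu.equation _ (contDiff_harmonicExt l m b) χ hχ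
  simp only [harmonicExt_sphPoint] at hg
  set g : ℝ → ℝ := fun s => ∫ q, coordField (u s) q * (realHarmonic l m b q.1 * χ q.2)
    ∂(angleMeasure.prod μ) with hgdef
  have hosc := abs_sub_le_of_damped_oscillator (b := ηinf) (α := 1 / c ^ 2)
    (β := 1 / r ^ 2 * (l * (l + 1))) (by positivity) (by positivity) (g := g)
    (d := dampingCoeff c D ηinf) (fun t ht => dampingCoeff_nonneg hD ht) hg hg₁
    (fun t ht => by
      have h1 := heq t ht
      rw [integral_mul_sphLaplacian_harmonicExt] at h1
      linear_combination h1) h0 hx hy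
  have hsqrt : 1 / r ^ 2 * ((l : ℝ) * (l + 1)) / (1 / c ^ 2) = c ^ 2 / r ^ 2 * (l * (l + 1)) := by
    field_simp
  rw [hsqrt] at hosc
  have hinit : g 0 = ∫ ω, τ ω * χ ω ∂μ := by
    rw [← integral_mul_realHarmonic_mul hTV hχ]
    refine integral_congr_ae ?_
    filter_upwards [hu.initial] with q hq
    simp only [coordField, hq]
  have hincr : g y - g x = ∫ ω, χ ω ^ 2 ∂μ := by
    have hH := memLp_realHarmonic_mul hχ l m b
    have hint : ∀ t ∈ Ico 0 ηinf, Integrable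
        (fun q => coordField (u t) q * (realHarmonic l m b q.1 * χ q.2)) (angleMeasure.prod μ) :=
      fun t ht => (hV t ht).integrable_mul hH
    simp only [hgdef]
    rw [← integral_sub (hint y hy) (hint x hx)]
    simp only [sq]
    nth_rewrite 2 [hχdef]
    rw [← integral_mul_realHarmonic_mul hΔ hχ]
    refine integral_congr_ae (Filter.Eventually.of_forall fun q => ?_)
    simp only [coordField]
    ring
  rw [hincr, hinit, abs_of_nonneg (integral_nonneg fun ω => sq_nonneg _)] at hosc
  set S : ℝ := c ^ 2 / r ^ 2 * (l * (l + 1)) with hS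
  have hS0 : 0 ≤ S := by positivity
  set κ : ℝ := Real.sqrt S * |y - x| with hκ
  have hκ0 : 0 ≤ κ := by positivity
  have hκ2 : κ ^ 2 = S * (y - x) ^ 2 := by rw [hκ, mul_pow, Real.sq_sqrt hS0, sq_abs]
  -- With `E χ² ≤ κ |E τχ|`, Young's inequality leaves `E χ² / 2` on the right, which is absorbed on
  -- the left.
  have hyoung : κ * |∫ ω, τ ω * χ ω ∂μ| ≤ ∫ ω, (κ ^ 2 * τ ω ^ 2 + χ ω ^ 2) / 2 ∂μ := by
    refine (mul_le_mul_of_nonneg_left abs_integral_le_integral_abs hκ0).trans ?_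
    rw [← integral_const_mul]
    refine integral_mono ((hτ.integrable_mul hχ).abs.const_mul κ)
      (((hτ.integrable_sq.const_mul _).add hχ.integrable_sq).div_const 2) fun ω => ?_
    simp only [abs_mul]
    rw [← sq_abs (τ ω), ← sq_abs (χ ω)]
    linarith [sq_nonneg (κ * |τ ω| - |χ ω|)]
  rw [integral_div, integral_add (hτ.integrable_sq.const_mul _) hχ.integrable_sq,
    integral_const_mul, hκ2] at hyoung
  have : Real.sqrt S * |∫ ω, τ ω * χ ω ∂μ| * |y - x| = κ * |∫ ω, τ ω * χ ω ∂μ| := by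
    rw [hκ]; ring
  linarith

end Field

end

/-! ### Summation over the degrees -/

theorem mainTheorem6 {Ω : Type*} [MeasurableSpace Ω] (μ : Measure Ω) [IsProbabilityMeasure μ]
    (c D r ηinf : ℝ) (hc : 0 < c) (hD : 0 < D) (hr : 0 < r) (hηinf : 0 < ηinf)
    (T : Sphere2 → Ω → ℝ) (hT : IsIsotropicGaussianField μ T)
    (u : ℝ → Sphere2 → Ω → ℝ) (hu : IsSolution c D r ηinf μ T u)
    (hsum : Summable fun l : ℕ => angularPowerSpectrum μ T l * (l : ℝ) ^ 3) :
    ∃ C : ℝ, 0 < C ∧ ∀ η ∈ Ico 0 ηinf, ∀ h ∈ Ioo 0 (ηinf - η),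
      fieldNorm μ (fun x ω => u (η + h) x ω - u η x ω) ≤ ENNReal.ofReal (C * h) := by
  set M : ℝ := 6 * (c ^ 2 / r ^ 2) * ∑' l : ℕ, angularPowerSpectrum μ T l * (l : ℝ) ^ 3
  have hterm : ∀ l : ℕ, 0 ≤ angularPowerSpectrum μ T l * (l : ℝ) ^ 3 := fun l =>
    mul_nonneg (angularPowerSpectrum_nonneg T l) (by positivity)
  have hM : 0 ≤ M := mul_nonneg (by positivity) (tsum_nonneg hterm)
  -- Adding `1` keeps the constant positive when `M = 0`.
  refine ⟨Real.sqrt M + 1, by positivity, fun η hη h hh => ?_⟩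
  have hη' : η + h ∈ Ico 0 ηinf := ⟨add_nonneg hη.1 hh.1.le, by linarith [hh.2]⟩
  have hΔ : MemLp (coordField fun x ω => u (η + h) x ω - u η x ω) 2 (angleMeasure.prod μ) :=
    MemLp.sub (hu.memL2 _ hη') (hu.memL2 _ hη)
  have hsq : fieldNorm μ (fun x ω => u (η + h) x ω - u η x ω) ^ 2 ≤ ENNReal.ofReal (M * h ^ 2) := by
    calc fieldNorm μ (fun x ω => u (η + h) x ω - u η x ω) ^ 2
        = ∑' l : ℕ, ENNReal.ofReal (∑ m ∈ Finset.Icc (-(l : ℤ)) l, ∑ b,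
            ∫ ω, realCoeff (coordField fun x ω => u (η + h) x ω - u η x ω) l m b ω ^ 2 ∂μ) :=
          (eLpNorm_two_sq _ _).trans (lintegral_enorm_sq_prod_eq_tsum hΔ)
      _ ≤ ∑' l : ℕ, ENNReal.ofReal (6 * (c ^ 2 / r ^ 2) * h ^ 2 *
            (angularPowerSpectrum μ T l * (l : ℝ) ^ 3)) := by
          refine ENNReal.tsum_le_tsum fun l => ENNReal.ofReal_le_ofReal ?_
          have h1 : ∑ m ∈ Finset.Icc (-(l : ℤ)) l, ∑ b,
              ∫ ω, realCoeff (coordField fun x ω => u (η + h) x ω - u η x ω) l m b ω ^ 2 ∂μ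
              ≤ c ^ 2 / r ^ 2 * (l * (l + 1)) * h ^ 2 *
                ((2 * l + 1) * angularPowerSpectrum μ T l) := by
            rw [← sum_realCoeff_sq_eq hT.memL2, Finset.mul_sum]
            refine Finset.sum_le_sum fun m hm => ?_
            rw [Finset.mul_sum]
            refine Finset.sum_le_sum fun b _ => ?_
            have := integral_realCoeff_increment_sq_le hc hD hu hT.memL2 hm b hη hη'
            rwa [add_sub_cancel_left] at this
          refine h1.trans ?_
          -- For `l ≥ 1`, `l + 1 ≤ 2l` and `2l + 1 ≤ 3l`, whence the `6` in `M`; at `l = 0` both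
          -- sides vanish.
          have h2 : (l : ℝ) * (l + 1) * (2 * l + 1) ≤ 6 * (l : ℝ) ^ 3 := by
            rcases Nat.eq_zero_or_pos l with rfl | hl
            · simp
            · have hl1 : (1 : ℝ) ≤ l := by exact_mod_cast hl
              have h3 : (l : ℝ) ≤ l ^ 2 := by nlinarith
              have h4 : (l : ℝ) ^ 2 ≤ l ^ 3 := by nlinarith
              nlinarith
          have h5 : 0 ≤ c ^ 2 / r ^ 2 * h ^ 2 * angularPowerSpectrum μ T l :=
            mul_nonneg (by positivity) (angularPowerSpectrum_nonneg T l)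
          linarith [mul_le_mul_of_nonneg_left h2 h5]
      _ = ENNReal.ofReal (M * h ^ 2) := by
          rw [← ENNReal.ofReal_tsum_of_nonneg
            (fun l => mul_nonneg (by positivity) (hterm l)) (hsum.mul_left _), tsum_mul_left]
          congr 1
          ring
  have hle : ENNReal.ofReal (M * h ^ 2) ≤ ENNReal.ofReal ((Real.sqrt M + 1) * h) ^ 2 := by
    rw [← ENNReal.ofReal_pow (mul_nonneg (by positivity) hh.1.le)]
    refine ENNReal.ofReal_le_ofReal ?_
    rw [mul_pow]
    refine mul_le_mul_of_nonneg_right ?_ (sq_nonneg h)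
    linarith [Real.sq_sqrt hM, Real.sqrt_nonneg M]
  exact (ENNReal.pow_le_pow_left_iff two_ne_zero).mp (hsq.trans hle)
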